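/- Fix an integer $g\ge 2$ and let $\Gamma_g=\langle a_1,b_1,\dots,a_g,b_g\mid [a_1,b_1]\cdots[a_g,b_g]\rangle$. A ($g$-)\emph{tiled surface} is an at most two-dimensional CW-complex $Y$ whose edges are directed and labeled by $a_1,b_1,\dots,a_g,b_g$ such that (P1) every vertex has at most one incoming and at most one outgoing edge with a given label; (P2) every path in the $1$-skeleton reading a word that is trivial in $\Gamma_g$ is closed; (P3) every $2$-cell is a $4g$-gon glued along a closed path reading $[a_1,b_1]\cdots[a_g,b_g]$, and every such closed path bounds at most one $2$-cell. (Equivalently, $Y$ is a sub-complex of a covering space of the closed genus $g$ surface with its standard one-vertex CW-structure.) It is compact if and only if it has finitely many cells. Morphisms map $i$-cells to $i$-cells and respect incidence, directions and labels; embeddings are injective morphisms. At each vertex of $Y$ add hanging half-edges so that there are $4g$ half-edges, with clockwise cyclic order $a_1$-outgoing, $b_1$-incoming, $a_1$-incoming, $b_1$-outgoing, $a_2$-outgoing, and so on. The boundary $\partial Y$ is the boundary of a thickening (regular neighborhood) of $Y$. Its components are read as paths of directed edges that have no $4g$-gon on their immediate left (cycles, or bi-infinite lines when $Y$ is not compact);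 from a directed edge such a component continues along the first half-edge, in clockwise order, that belongs to an edge of $Y$. The length $|\partial Y|$ is the number of sides of edges that do not border a $4g$-gon. A \emph{block} is a non-empty path with no half-edges (hanging or not) between successive edges. A \emph{half-block} is a block of length $2g$ and a \emph{long block} is a block of length at least $2g+1$. Two blocks are \emph{consecutive} if the second starts where the first ends, with exactly one half-edge in between. A \emph{long chain} is a path made of consecutive blocks of lengths $2g,2g-1,\dots,2g-1,2g$ (at least two blocks), and a \emph{half-chain} is a cycle made of cyclically consecutive blocks of length $2g-1$. $Y$ is \emph{boundary reduced} if no component of $\partial Y$ contains a long block or a long chain, and \emph{strongly boundary reduced} if no component of $\partial Y$ contains a half-block or a half-chain. If $Y$ is embedded in a (strongly) boundary reduced tiled surface $Z$, then $\mathsf{BR}(Y\hookrightarrow Z)$ (respectively $\mathsf{SBR}(Y\hookrightarrow Z)$) is the intersection of all (strongly) boundary reduced sub-complexes of $Z$ that contain $Y$. \textbf{Proposition.} Let $g\ge2$ and let $Y$ be a compact $g$-tiled surface embedded in a boundary reduced $g$-tiled surface $Z$. Then $\mathsf{BR}(Y\hookrightarrow Z)$ is compact. Moreover, it is obtained from $Y$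 by adding finitely many closed $4g$-gons: there are sub-complexes $Y=Y_0,Y_1,\dots,Y_n=\mathsf{BR}(Y\hookrightarrow Z)$ of $Z$ such that, for each $i<n$, $Y_{i+1}$ is the union of $Y_i$ and all closed $4g$-gons of $Z$ that sit on the left of some directed edge of a certain long block or long chain contained in $\partial Y_i$, and $|\partial Y_{i+1}|\le|\partial Y_i|-2$. The analogous compactness statement fails for the strongly boundary reduced closure: already for $g=2$ there are a strongly boundary reduced tiled surface $Z$ and a compact tiled surface $Y$ embedded in $Z$ such that $\mathsf{SBR}(Y\hookrightarrow Z)$ is not compact. -/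

import Mathlib

universe u v

/-- The generators `a_1, b_1, …, a_g, b_g` of the surface group of genus `g`. -/
inductive SurfaceGen (g : ℕ) : Type
  | a (i : Fin g) : SurfaceGen g
  | b (i : Fin g) : SurfaceGen g

/-- Letters `a_i^{±1}, b_i^{±1}`; the sign `true` means exponent `+1`. -/
abbrev Letter (g : ℕ) : Type := SurfaceGen g × Bool

namespace Letter

variable {g : ℕ}

/-- The inverse letter. -/
def inv (x : Letter g) : Letter g := (x.1, !x.2)

/-- The clockwise cyclic order on the `4g` half-edges at the vertex of the genus `g` surface,
where a half-edge is named by the letter read when one leaves the vertex along it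
(so "`a_i`-outgoing" is `a_i` and "`a_i`-incoming" is `a_i⁻¹`): the half-edge that follows
a given one is determined by
`a_i`-outgoing, `b_i`-incoming, `a_i`-incoming, `b_i`-outgoing, `a_{i+1}`-outgoing, … -/
def clockwise : Letter g → Letter g
  | (.a i, true) => (.b i, false)
  | (.b i, false) => (.a i, false)
  | (.a i, false) => (.b i, true)
  | (.b i, true) => (.a (finRotate g i), true)

end Letter

/-- The word `[a_1, b_1] ⋯ [a_g, b_g]`. -/
def surfaceRelator (g : ℕ) : List (Letter g) :=
  (List.finRange g).flatMap fun i =>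
    [(.a i, true), (.b i, true), (.a i, false), (.b i, false)]

/-- The surface group `⟨a_1, b_1, …, a_g, b_g | [a_1, b_1] ⋯ [a_g, b_g]⟩`. -/
abbrev SurfaceGroup (g : ℕ) : Type :=
  PresentedGroup ({FreeGroup.mk (surfaceRelator g)} : Set (FreeGroup (SurfaceGen g)))

/-- The element of the surface group represented by a word. -/
def wordValue {g : ℕ} (w : List (Letter g)) : SurfaceGroup g :=
  PresentedGroup.mk _ (FreeGroup.mk w)

/-! ### Paths in directed, labeled graphs

`V` and `E` are the vertices and edges, `src`, `tgt`, `label` the initial vertex, terminal vertex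
and label of an edge. A dart `(e, true)` is the edge `e` traversed in its own direction, and
`(e, false)` is `e` traversed against its direction. -/

namespace LabeledGraph

variable {V : Type u} {E : Type u} {g : ℕ}

def dartSrc (src tgt : E → V) (d : E × Bool) : V := if d.2 then src d.1 else tgt d.1

def dartTgt (src tgt : E → V) (d : E × Bool) : V := if d.2 then tgt d.1 else src d.1

def dartLetter (label : E → SurfaceGen g) (d : E × Bool) : Letter g := (label d.1, d.2)

/-- A sequence of darts, each starting where the previous one ends. -/
def IsPath (src tgt : E → V) (p : List (E × Bool)) : Prop :=
  p.IsChain fun d d' => dartTgt src tgt d = dartSrc src tgt d'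

/-- The path starts and ends at the same vertex. -/
def IsClosed (src tgt : E → V) (p : List (E × Bool)) : Prop :=
  p.head?.map (dartSrc src tgt) = p.getLast?.map (dartTgt src tgt)

end LabeledGraph

/-- A `g`-tiled surface: an at most two-dimensional CW-complex with vertices `V`, edges `E` and
2-cells `F`, whose edges are directed and labeled by the generators, subject to the properties
P1, P2, P3. The attaching path `bdry f` of a 2-cell `f` is written from its unique starting point
at which it reads the word `[a_1, b_1] ⋯ [a_g, b_g]`. -/
structure TiledSurface (g : ℕ) : Type (u + 1) where
  V : Type u
  E : Type u
  F : Type u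
  src : E → V
  tgt : E → V
  label : E → SurfaceGen g
  bdry : F → List (E × Bool)
  /-- P1: at most one outgoing edge with a given label at each vertex. -/
  out_unique : ∀ e e' : E, src e = src e' → label e = label e' → e = e'
  /-- P1: at most one incoming edge with a given label at each vertex. -/
  in_unique : ∀ e e' : E, tgt e = tgt e' → label e = label e' → e = e'
  /-- P2: a path that reads a word representing the identity of the surface group is closed. -/
  closed_of_trivial : ∀ p : List (E × Bool), LabeledGraph.IsPath src tgt p →
    wordValue (p.map (LabeledGraph.dartLetter label)) = 1 → LabeledGraph.IsClosed src tgt p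
  /-- P3: every 2-cell is a `4g`-gon glued along a closed path reading the relator. -/
  bdry_isPath : ∀ f, LabeledGraph.IsPath src tgt (bdry f)
  bdry_isClosed : ∀ f, LabeledGraph.IsClosed src tgt (bdry f)
  bdry_word : ∀ f, (bdry f).map (LabeledGraph.dartLetter label) = surfaceRelator g
  /-- P3: every such closed path bounds at most one 2-cell. -/
  bdry_injective : Function.Injective bdry

namespace TiledSurface

variable {g : ℕ}

section Basic

variable (Y : TiledSurface.{u} g)

/-- Directed edges. -/
abbrev Dart : Type u := Y.E × Bool

def dsrc (d : Y.Dart) : Y.V := LabeledGraph.dartSrc Y.src Y.tgt d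

def dtgt (d : Y.Dart) : Y.V := LabeledGraph.dartTgt Y.src Y.tgt d

def letter (d : Y.Dart) : Letter g := LabeledGraph.dartLetter Y.label d

/-- A CW-complex is compact iff it has finitely many cells. -/
def IsCompact : Prop := Finite Y.V ∧ Finite Y.E ∧ Finite Y.F

/-- The dart `d'` starts where `d` ends, and in the clockwise order at this vertex there are
exactly `m` half-edges (hanging or not) between `d` and `d'`, `0 ≤ m ≤ 4g - 1`. -/
def Between (d d' : Y.Dart) (m : ℕ) : Prop :=
  Y.dtgt d = Y.dsrc d' ∧ m < 4 * g ∧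
    Letter.clockwise^[m + 1] (Letter.inv (Y.letter d)) = Y.letter d'

/-- The half-edge named `x` at the vertex `v` is hanging: it is not part of an edge of `Y`. -/
def IsHanging (v : Y.V) (x : Letter g) : Prop :=
  ¬ ∃ d : Y.Dart, Y.dsrc d = v ∧ Y.letter d = x

/-- The `4g`-gon `f` is on the left of the dart `d`: the attaching paths of 2-cells are
oriented so that the 2-cell is on the left. -/
def LeftOf (f : Y.F) (d : Y.Dart) : Prop := d ∈ Y.bdry f

/-- The dart `d` runs along the boundary of the thick version of `Y`: there is no `4g`-gon on
its immediate left. -/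
def IsBoundaryDart (d : Y.Dart) : Prop := ∀ f, ¬ Y.LeftOf f d

/-- The length of the boundary: the number of sides of edges without a `4g`-gon. -/
noncomputable def boundaryLength : ℕ := Set.ncard {d : Y.Dart | Y.IsBoundaryDart d}

/-- The boundary component of the thick version that runs along `d` continues along `d'`:
all half-edges between `d` and `d'` are hanging. -/
def BoundaryNext (d d' : Y.Dart) : Prop :=
  ∃ m, Y.Between d d' m ∧
    ∀ k, 1 ≤ k → k ≤ m → Y.IsHanging (Y.dtgt d) (Letter.clockwise^[k] (Letter.inv (Y.letter d)))

/-- A path contained in a boundary component of (the thick version of) `Y`. -/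
def IsBoundaryPath (p : List Y.Dart) : Prop :=
  (∀ d ∈ p, Y.IsBoundaryDart d) ∧ p.IsChain Y.BoundaryNext

/-- A boundary component of (the thick version of) `Y` that is a cycle. -/
def IsBoundaryCycle (p : List Y.Dart) : Prop :=
  p ≠ [] ∧ Y.IsBoundaryPath p ∧ ∀ d ∈ p.getLast?, ∀ d' ∈ p.head?, Y.BoundaryNext d d'

/-- A block: a non-empty path with no half-edges between successive edges. -/
def IsBlock (p : List Y.Dart) : Prop := p ≠ [] ∧ p.IsChain fun d d' => Y.Between d d' 0

def IsHalfBlock (p : List Y.Dart) : Prop := Y.IsBlock p ∧ p.length = 2 * g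

def IsLongBlock (p : List Y.Dart) : Prop := Y.IsBlock p ∧ 2 * g + 1 ≤ p.length

/-- Two blocks are consecutive if there is exactly one half-edge between the last edge of the
first one and the first edge of the second one. -/
def Consecutive (p q : List Y.Dart) : Prop :=
  ∀ d ∈ p.getLast?, ∀ d' ∈ q.head?, Y.Between d d' 1

/-- A chain: a sequence of consecutive blocks. -/
def IsBlockChain (B : List (List Y.Dart)) : Prop :=
  (∀ p ∈ B, Y.IsBlock p) ∧ B.IsChain Y.Consecutive

/-- A long chain: consecutive blocks of lengths `2g, 2g-1, …, 2g-1, 2g`. -/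
def IsLongChain (p : List Y.Dart) : Prop :=
  ∃ (B : List (List Y.Dart)) (k : ℕ), p = B.flatten ∧ Y.IsBlockChain B ∧
    B.map List.length = 2 * g :: (List.replicate k (2 * g - 1) ++ [2 * g])

/-- A half-chain: a cyclic chain of consecutive blocks of length `2g-1` each. -/
def IsHalfChain (p : List Y.Dart) : Prop :=
  ∃ B : List (List Y.Dart), B ≠ [] ∧ p = B.flatten ∧ Y.IsBlockChain B ∧
    (∀ q ∈ B, q.length = 2 * g - 1) ∧
    ∀ q ∈ B.getLast?, ∀ q' ∈ B.head?, Y.Consecutive q q'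

/-- No boundary component contains a long block or a long chain. -/
def BoundaryReduced : Prop :=
  ∀ p : List Y.Dart, Y.IsBoundaryPath p → ¬ Y.IsLongBlock p ∧ ¬ Y.IsLongChain p

/-- No boundary component contains a half-block or a half-chain. -/
def StronglyBoundaryReduced : Prop :=
  (∀ p : List Y.Dart, Y.IsBoundaryPath p → ¬ Y.IsHalfBlock p) ∧
    ∀ p : List Y.Dart, Y.IsBoundaryCycle p → ¬ Y.IsHalfChain p

end Basic

/-- Morphisms of tiled surfaces: they map `i`-cells to `i`-cells and respect incidences,
directions and labels. -/
structure Hom (Y : TiledSurface.{u} g) (Z : TiledSurface.{v} g) where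
  onV : Y.V → Z.V
  onE : Y.E → Z.E
  onF : Y.F → Z.F
  src_onE : ∀ e, Z.src (onE e) = onV (Y.src e)
  tgt_onE : ∀ e, Z.tgt (onE e) = onV (Y.tgt e)
  label_onE : ∀ e, Z.label (onE e) = Y.label e
  bdry_onF : ∀ f, Z.bdry (onF f) = (Y.bdry f).map (Prod.map onE id)

/-- An embedding is a morphism that is injective on cells. -/
def Hom.IsEmbedding {Y : TiledSurface.{u} g} {Z : TiledSurface.{v} g} (φ : Hom Y Z) : Prop :=
  Function.Injective φ.onV ∧ Function.Injective φ.onE ∧ Function.Injective φ.onF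

/-- Sub-complexes of a tiled surface: sets of cells that contain, with each cell, the cells of
smaller dimension at its boundary. -/
@[ext]
structure Subcomplex (Z : TiledSurface.{u} g) where
  verts : Set Z.V
  edges : Set Z.E
  faces : Set Z.F
  src_mem : ∀ e ∈ edges, Z.src e ∈ verts
  tgt_mem : ∀ e ∈ edges, Z.tgt e ∈ verts
  bdry_mem : ∀ f ∈ faces, ∀ d ∈ Z.bdry f, d.1 ∈ edges

namespace Subcomplex

variable {Z : TiledSurface.{u} g}

instance : LE (Subcomplex Z) where
  le X X' := X.verts ⊆ X'.verts ∧ X.edges ⊆ X'.edges ∧ X.faces ⊆ X'.faces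

/-- The intersection of a family of sub-complexes. -/
def inter (S : Set (Subcomplex Z)) : Subcomplex Z where
  verts := {v | ∀ X ∈ S, v ∈ X.verts}
  edges := {e | ∀ X ∈ S, e ∈ X.edges}
  faces := {f | ∀ X ∈ S, f ∈ X.faces}
  src_mem e he X hX := X.src_mem e (he X hX)
  tgt_mem e he X hX := X.tgt_mem e (he X hX)
  bdry_mem f hf d hd X hX := X.bdry_mem f (hf X hX) d hd

/-- The union of a sub-complex with a set of closed `4g`-gons. -/
def adjoin (X : Subcomplex Z) (S : Set Z.F) : Subcomplex Z where
  verts := X.verts ∪ {v | ∃ f ∈ S, ∃ d ∈ Z.bdry f, v = Z.src d.1 ∨ v = Z.tgt d.1}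
  edges := X.edges ∪ {e | ∃ f ∈ S, ∃ d ∈ Z.bdry f, e = d.1}
  faces := X.faces ∪ S
  src_mem := by
    rintro e (he | ⟨f, hf, d, hd, rfl⟩)
    · exact Or.inl (X.src_mem e he)
    · exact Or.inr ⟨f, hf, d, hd, Or.inl rfl⟩
  tgt_mem := by
    rintro e (he | ⟨f, hf, d, hd, rfl⟩)
    · exact Or.inl (X.tgt_mem e he)
    · exact Or.inr ⟨f, hf, d, hd, Or.inr rfl⟩
  bdry_mem := by
    rintro f (hf | hf) d hd
    · exact Or.inl (X.bdry_mem f hf d hd)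
    · exact Or.inr ⟨f, hf, d, hd, rfl⟩

/-- A dart of a sub-complex, as a dart of the ambient tiled surface. -/
def toAmbient (X : Subcomplex Z) (d : X.edges × Bool) : Z.E × Bool := (d.1.1, d.2)

/-- The attaching path of a 2-cell of a sub-complex. -/
def subBdry (X : Subcomplex Z) (f : X.faces) : List (X.edges × Bool) :=
  (Z.bdry f.1).attach.map fun d => (⟨d.1.1, X.bdry_mem f.1 f.2 d.1 d.2⟩, d.1.2)

theorem map_subBdry (X : Subcomplex Z) (f : X.faces) :
    (X.subBdry f).map X.toAmbient = Z.bdry f.1 := by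
  rw [subBdry, List.map_map]
  exact List.attach_map_subtype_val _

/-- Initial vertex of an edge of a sub-complex. -/
def subSrc (X : Subcomplex Z) (e : X.edges) : X.verts := ⟨Z.src e.1, X.src_mem e.1 e.2⟩

/-- Terminal vertex of an edge of a sub-complex. -/
def subTgt (X : Subcomplex Z) (e : X.edges) : X.verts := ⟨Z.tgt e.1, X.tgt_mem e.1 e.2⟩

theorem coe_dartSrc (X : Subcomplex Z) (d : X.edges × Bool) :
    (LabeledGraph.dartSrc X.subSrc X.subTgt d).1
      = LabeledGraph.dartSrc Z.src Z.tgt (X.toAmbient d) := by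
  rcases d with ⟨e, _ | _⟩ <;> rfl

theorem coe_dartTgt (X : Subcomplex Z) (d : X.edges × Bool) :
    (LabeledGraph.dartTgt X.subSrc X.subTgt d).1
      = LabeledGraph.dartTgt Z.src Z.tgt (X.toAmbient d) := by
  rcases d with ⟨e, _ | _⟩ <;> rfl

theorem isPath_iff (X : Subcomplex Z) (p : List (X.edges × Bool)) :
    LabeledGraph.IsPath X.subSrc X.subTgt p ↔
      LabeledGraph.IsPath Z.src Z.tgt (p.map X.toAmbient) := by
  simp only [LabeledGraph.IsPath, List.isChain_map, ← coe_dartSrc, ← coe_dartTgt,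
    Subtype.coe_inj]

theorem isClosed_iff (X : Subcomplex Z) (p : List (X.edges × Bool)) :
    LabeledGraph.IsClosed X.subSrc X.subTgt p ↔
      LabeledGraph.IsClosed Z.src Z.tgt (p.map X.toAmbient) := by
  unfold LabeledGraph.IsClosed
  rw [List.head?_map, List.getLast?_map]
  cases p.head? <;> cases p.getLast? <;>
    simp [← coe_dartSrc, ← coe_dartTgt, Subtype.coe_inj]

/-- A sub-complex of a tiled surface, as a tiled surface for its own sake. -/
def toTiledSurface (X : Subcomplex Z) : TiledSurface.{u} g where
  V := X.verts
  E := X.edges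
  F := X.faces
  src := X.subSrc
  tgt := X.subTgt
  label e := Z.label e.1
  bdry := X.subBdry
  out_unique e e' h h' := Subtype.ext (Z.out_unique _ _ (congrArg Subtype.val h) h')
  in_unique e e' h h' := Subtype.ext (Z.in_unique _ _ (congrArg Subtype.val h) h')
  closed_of_trivial p hp hw := by
    rw [isClosed_iff]
    refine Z.closed_of_trivial _ ((isPath_iff X p).1 hp) ?_
    rw [List.map_map]
    exact hw
  bdry_isPath f := by
    rw [isPath_iff, map_subBdry]
    exact Z.bdry_isPath f.1
  bdry_isClosed f := by
    rw [isClosed_iff, map_subBdry]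
    exact Z.bdry_isClosed f.1
  bdry_word f := by
    rw [← Z.bdry_word f.1, ← map_subBdry, List.map_map]
    rfl
  bdry_injective f f' h := by
    apply Subtype.ext
    apply Z.bdry_injective
    rw [← map_subBdry, ← map_subBdry, h]

/-- The `4g`-gons of the ambient tiled surface that sit along a path of a sub-complex
(on its left). -/
def facesAlong (X : Subcomplex Z) (p : List X.toTiledSurface.Dart) : Set Z.F :=
  {f | ∃ d ∈ p, Z.LeftOf f (X.toAmbient d)}

/-- `X'` arises from `X` by adding all closed `4g`-gons of the ambient tiled surface that sit
along some long block or some long chain contained in the boundary of `X`. -/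
def Step (X X' : Subcomplex Z) : Prop :=
  ∃ p : List X.toTiledSurface.Dart, X.toTiledSurface.IsBoundaryPath p ∧
    (X.toTiledSurface.IsLongBlock p ∨ X.toTiledSurface.IsLongChain p) ∧
    X' = X.adjoin (X.facesAlong p)

end Subcomplex

namespace Hom

variable {Y : TiledSurface.{u} g} {Z : TiledSurface.{v} g}

/-- The image of a morphism. -/
def range (φ : Hom Y Z) : Subcomplex Z where
  verts := Set.range φ.onV
  edges := Set.range φ.onE
  faces := Set.range φ.onF
  src_mem := by
    rintro _ ⟨e, rfl⟩
    exact ⟨_, (φ.src_onE e).symm⟩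
  tgt_mem := by
    rintro _ ⟨e, rfl⟩
    exact ⟨_, (φ.tgt_onE e).symm⟩
  bdry_mem := by
    rintro _ ⟨f, rfl⟩ d hd
    rw [φ.bdry_onF, List.mem_map] at hd
    obtain ⟨d', -, rfl⟩ := hd
    exact ⟨d'.1, rfl⟩

/-- The boundary reduced closure: the intersection of all boundary reduced tiled surfaces that
lie between the image of `Y` and `Z`. -/
def brClosure (φ : Hom Y Z) : Subcomplex Z :=
  Subcomplex.inter {X | φ.range ≤ X ∧ X.toTiledSurface.BoundaryReduced}

/-- The strongly boundary reduced closure: the intersection of all strongly boundary reduced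
tiled surfaces that lie between the image of `Y` and `Z`. -/
def sbrClosure (φ : Hom Y Z) : Subcomplex Z :=
  Subcomplex.inter {X | φ.range ≤ X ∧ X.toTiledSurface.StronglyBoundaryReduced}

end Hom

end TiledSurface

/-!
A block that has a `4g`-gon of `Z` on the left of one of its darts has it on the left of all of
them. Hence, as `Z` is boundary reduced, every long block of `Y` has a `4g`-gon of `Z` on its
left. So does every block of a long chain of `Y`. Otherwise take a maximal run of blocks of the
chain that have no `4g`-gon. If a block with a `4g`-gon precedes the run, then the edge between
them prolongs the first block of the run backwards, and symmetrically at the end of the run: the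
run becomes a long chain or a long block in the boundary of `Z`. Every step therefore stays
inside every boundary reduced sub-complex that contains the previous one.

A step adds `4g`-gons along a long block or a long chain of the boundary. Each of them hides the
sides that it shares with the previous sub-complex and exposes at most its other sides. For a
long block the balance is at least `(2g + 1) - (2g - 1) = 2`. In a long chain, the edge between
two consecutive blocks belongs to the `4g`-gons along both, hence is not exposed, so that the
balance is at least `2g - (2g - 1) = 1` for the first and the last block, and
`(2g - 1) - (2g - 1) = 0` for the others. Thus the length of the boundary drops by at least two
in each step, and the steps end, at the least boundary reduced sub-complex.

For the counterexample, consider the infinite cyclic covering in which successive octagons share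
a half-block: a strongly boundary reduced sub-complex that contains one of them contains the
next.
-/

theorem forall_and_of_isChain_cons_concat {α : Type*} {P Q : α → Prop} {a b : α} {l : List α}
    (h : (a :: (l ++ [b])).IsChain fun x y => P x ∧ Q y) :
    P a ∧ Q b ∧ ∀ c ∈ l, P c ∧ Q c := by
  induction l generalizing a with
  | nil => simpa using h
  | cons c l ih =>
    obtain ⟨⟨ha, hc⟩, h⟩ := List.isChain_cons_cons.1 h
    obtain ⟨hc', hb, hl⟩ := ih h
    exact ⟨ha, hb, List.forall_mem_cons.2 ⟨⟨hc', hc⟩, hl⟩⟩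

theorem target_getLast_eq_source_head_add_sum {D A : Type*} [AddMonoid A] {s t c : D → A}
    (h : ∀ d, t d = s d + c d) {p : List D} (hp : p.IsChain fun d d' => t d = s d')
    (hne : p ≠ []) : t (p.getLast hne) = s (p.head hne) + (p.map c).sum := by
  induction p with
  | nil => exact absurd rfl hne
  | cons d p ih =>
    cases p with
    | nil => simpa using h d
    | cons d' p =>
      obtain ⟨hd, hp⟩ := List.isChain_cons_cons.1 hp
      rw [List.getLast_cons_cons, ih hp (List.cons_ne_nil _ _), List.head_cons, ← hd, h,
        List.map_cons (a := d), List.sum_cons, add_assoc, List.head_cons]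

/-! ### Letters, darts and blocks -/

namespace Letter

variable {g : ℕ}

/-- The letter that follows `x` in the cyclic word `[a_1, b_1] ⋯ [a_g, b_g]`. It is read off the
clockwise order because a `4g`-gon turns, at each of its corners, into the next half-edge. -/
def next (x : Letter g) : Letter g := clockwise (inv x)

/-- The position of a letter in the word `[a_1, b_1] ⋯ [a_g, b_g]`, counted from `0`. -/
def rank : Letter g → ℕ
  | (.a i, true) => 4 * i
  | (.b i, true) => 4 * i + 1
  | (.a i, false) => 4 * i + 2
  | (.b i, false) => 4 * i + 3

theorem rank_lt (x : Letter g) : x.rank < 4 * g := by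
  rcases x with ⟨i | i, _ | _⟩ <;> simp only [rank] <;> omega

theorem genus_pos (x : Letter g) : 0 < g := by
  have := x.rank_lt
  omega

theorem rank_injective : Function.Injective (rank (g := g)) := by
  rintro ⟨i | i, _ | _⟩ ⟨j | j, _ | _⟩ h <;> simp only [rank] at h <;>
    first
      | omega
      | (have : i = j := Fin.ext (by omega)
         rw [this])

theorem inv_inv (x : Letter g) : inv (inv x) = x := by
  rcases x with ⟨i | i, _ | _⟩ <;> rfl

theorem clockwise_ne_self (x : Letter g) : clockwise x ≠ x := by
  rcases x with ⟨i | i, _ | _⟩ <;> simp [clockwise]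

theorem clockwise_injective : Function.Injective (clockwise (g := g)) := by
  rintro ⟨i | i, _ | _⟩ ⟨j | j, _ | _⟩ h <;> simp_all [clockwise]

theorem next_injective : Function.Injective (next (g := g)) := fun x y h => by
  rw [← inv_inv x, clockwise_injective h, inv_inv]

theorem next_surjective : Function.Surjective (next (g := g))
  | (.a i, true) => ⟨(.b ((finRotate g).symm i), false),
      congrArg (fun j => (SurfaceGen.a j, true)) ((finRotate g).apply_symm_apply i)⟩
  | (.b i, true) => ⟨(.a i, true), rfl⟩
  | (.a i, false) => ⟨(.b i, true), rfl⟩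
  | (.b i, false) => ⟨(.a i, false), rfl⟩

theorem rank_next (x : Letter g) : (next x).rank = (x.rank + 1) % (4 * g) := by
  have hx := x.rank_lt
  rcases x with ⟨i | i, _ | _⟩
  case a.false | a.true | b.true =>
    simp only [next, inv, clockwise, rank, Bool.not_false, Bool.not_true] at *
    rw [Nat.mod_eq_of_lt (by omega)]
  case b.false =>
    simp only [next, inv, clockwise, rank, Bool.not_false] at *
    obtain ⟨n, rfl⟩ := Nat.exists_eq_add_one_of_ne_zero (i.pos.ne')
    rw [finRotate_apply, Fin.val_add_one]
    split_ifs with h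
    · rw [h, Fin.val_last, show 4 * n + 3 + 1 = 4 * (n + 1) by ring, Nat.mod_self]
    · have : (i : ℕ) ≠ n := fun h' => h (Fin.ext h')
      rw [Nat.mod_eq_of_lt (by omega)]
      ring

end Letter

theorem surfaceRelator_map_rank (g : ℕ) :
    (surfaceRelator g).map Letter.rank = List.range (4 * g) := by
  have flatMap_range (n : ℕ) :
      (List.range n).flatMap (fun i => [4 * i, 4 * i + 1, 4 * i + 2, 4 * i + 3])
        = List.range (4 * n) := by
    induction n with
    | zero => rfl
    | succ n ih =>
      rw [List.range_succ, List.flatMap_append, ih,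
        show 4 * (n + 1) = 4 * n + 1 + 1 + 1 + 1 by ring]
      simp [List.range_succ]
  rw [← flatMap_range, surfaceRelator, List.map_flatMap, ← List.map_coe_finRange_eq_range,
    List.flatMap_map]
  rfl

theorem surfaceRelator_length (g : ℕ) : (surfaceRelator g).length = 4 * g := by
  rw [← List.length_map (f := Letter.rank), surfaceRelator_map_rank, List.length_range]

namespace TiledSurface

variable {g : ℕ}

section Darts

variable (Z : TiledSurface.{u} g)

/-- The dart that traverses the same edge backwards. -/
def rev (d : Z.Dart) : Z.Dart := (d.1, !d.2)

/-- The dart `d'` follows `d` in a block, that is, there is no half-edge between them. -/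
def Follows (d d' : Z.Dart) : Prop :=
  Z.dtgt d = Z.dsrc d' ∧ (Z.letter d).next = Z.letter d'

variable {Z}

theorem rev_rev (d : Z.Dart) : Z.rev (Z.rev d) = d := by
  simp [rev]

theorem dsrc_rev (d : Z.Dart) : Z.dsrc (Z.rev d) = Z.dtgt d := by
  rcases d with ⟨e, _ | _⟩ <;> rfl

theorem dtgt_rev (d : Z.Dart) : Z.dtgt (Z.rev d) = Z.dsrc d := by
  rcases d with ⟨e, _ | _⟩ <;> rfl

theorem letter_rev (d : Z.Dart) : Z.letter (Z.rev d) = (Z.letter d).inv := rfl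

theorem dart_eq_of_dsrc {d d' : Z.Dart} (h : Z.dsrc d = Z.dsrc d')
    (hl : Z.letter d = Z.letter d') : d = d' := by
  rcases d with ⟨e, s⟩
  rcases d' with ⟨e', s'⟩
  obtain ⟨hlabel, hsign⟩ := Prod.ext_iff.1 hl
  simp only [letter, LabeledGraph.dartLetter] at hlabel hsign
  subst hsign
  cases s
  · rw [Z.in_unique e e' h hlabel]
  · rw [Z.out_unique e e' h hlabel]

theorem dart_eq_of_dtgt {d d' : Z.Dart} (h : Z.dtgt d = Z.dtgt d')
    (hl : Z.letter d = Z.letter d') : d = d' := by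
  have : Z.rev d = Z.rev d' := dart_eq_of_dsrc (by rw [dsrc_rev, dsrc_rev, h])
    (by rw [letter_rev, letter_rev, hl])
  rw [← rev_rev d, this, rev_rev]

theorem between_zero_iff {d d' : Z.Dart} : Z.Between d d' 0 ↔ Z.Follows d d' := by
  have := (Z.letter d).genus_pos
  exact ⟨fun h => ⟨h.1, h.2.2⟩, fun h => ⟨h.1, by omega, h.2⟩⟩

theorem isBlock_iff {p : List Z.Dart} : Z.IsBlock p ↔ p ≠ [] ∧ p.IsChain Z.Follows := by
  simp only [IsBlock, between_zero_iff]

theorem Follows.right_unique {d d₁ d₂ : Z.Dart} (h₁ : Z.Follows d d₁) (h₂ : Z.Follows d d₂) :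
    d₁ = d₂ :=
  dart_eq_of_dsrc (h₁.1.symm.trans h₂.1) (h₁.2.symm.trans h₂.2)

theorem Follows.left_unique {d d₁ d₂ : Z.Dart} (h₁ : Z.Follows d₁ d) (h₂ : Z.Follows d₂ d) :
    d₁ = d₂ :=
  dart_eq_of_dtgt (h₁.1.trans h₂.1.symm) (Letter.next_injective (h₁.2.trans h₂.2.symm))

theorem nodup_of_isChain_follows {p : List Z.Dart} (hp : p.IsChain Z.Follows)
    (hl : p.length ≤ 4 * g) : p.Nodup := by
  have rank_getElem (i : ℕ) (hi : i < p.length) :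
      (Z.letter p[i]).rank = ((Z.letter p[0]).rank + i) % (4 * g) := by
    induction i with
    | zero => rw [Nat.add_zero, Nat.mod_eq_of_lt (Letter.rank_lt _)]
    | succ i ih =>
      rw [← (List.isChain_iff_getElem.1 hp i hi).2, Letter.rank_next, ih (by omega),
        Nat.mod_add_mod, add_assoc]
  rw [List.nodup_iff_injective_getElem]
  rintro ⟨i, hi⟩ ⟨j, hj⟩ h
  have hmod : ((Z.letter p[0]).rank + i) % (4 * g) = ((Z.letter p[0]).rank + j) % (4 * g) := by
    rw [← rank_getElem i hi, ← rank_getElem j hj]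
    exact congrArg (fun d => (Z.letter d).rank) h
  have : i ≡ j [MOD 4 * g] := Nat.ModEq.add_left_cancel' _ hmod
  exact Fin.ext (this.eq_of_lt_of_lt (by omega) (by omega))

theorem bdry_length (f : Z.F) : (Z.bdry f).length = 4 * g := by
  rw [← surfaceRelator_length, ← Z.bdry_word f, List.length_map]

theorem rank_bdry_getElem (f : Z.F) (i : ℕ) (hi : i < (Z.bdry f).length) :
    (Z.letter (Z.bdry f)[i]).rank = i := by
  have h : (Z.bdry f).map (Letter.rank ∘ Z.letter) = List.range (4 * g) := by
    rw [← surfaceRelator_map_rank, ← Z.bdry_word f, List.map_map]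
    rfl
  have hi' : i < ((Z.bdry f).map (Letter.rank ∘ Z.letter)).length := by rwa [List.length_map]
  simpa only [List.getElem_map, List.getElem_range, Function.comp_apply]
    using List.getElem_of_eq h hi'

/-- The side of the `4g`-gon `f` that reads the letter `x`. -/
def side (f : Z.F) (x : Letter g) : Z.Dart :=
  (Z.bdry f)[x.rank]'(by rw [bdry_length]; exact x.rank_lt)

theorem leftOf_side (f : Z.F) (x : Letter g) : Z.LeftOf f (side f x) := List.getElem_mem _

theorem letter_side (f : Z.F) (x : Letter g) : Z.letter (side f x) = x :=
  Letter.rank_injective (rank_bdry_getElem f _ _)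

theorem leftOf_iff_side_eq {f : Z.F} {d : Z.Dart} : Z.LeftOf f d ↔ side f (Z.letter d) = d := by
  refine ⟨fun h => ?_, fun h => h ▸ leftOf_side f _⟩
  obtain ⟨i, hi, rfl⟩ := List.getElem_of_mem h
  simp only [side, rank_bdry_getElem]

theorem map_side_surfaceRelator (f : Z.F) : (surfaceRelator g).map (side f) = Z.bdry f := by
  rw [← Z.bdry_word f, List.map_map]
  exact (List.map_congr_left fun d hd => leftOf_iff_side_eq.1 hd).trans (List.map_id _)

theorem isChain_follows_bdry (f : Z.F) : (Z.bdry f).IsChain Z.Follows := by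
  refine List.isChain_iff_getElem.2 fun i hi =>
    ⟨List.isChain_iff_getElem.1 (Z.bdry_isPath f) i hi, Letter.rank_injective ?_⟩
  rw [Letter.rank_next, rank_bdry_getElem, rank_bdry_getElem,
    Nat.mod_eq_of_lt (by rwa [← bdry_length f])]

theorem dtgt_bdry_last (f : Z.F) (x y : Letter g) (hx : x.rank = 4 * g - 1) (hy : y.rank = 0) :
    Z.dtgt (side f x) = Z.dsrc (side f y) := by
  have hpos := x.genus_pos
  have hlen := bdry_length f
  have hc := Z.bdry_isClosed f
  rw [LabeledGraph.IsClosed, List.head?_eq_getElem?, List.getLast?_eq_getElem?,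
    List.getElem?_eq_getElem (by omega), List.getElem?_eq_getElem (by omega)] at hc
  simp only [hlen, Option.map_some, Option.some.injEq] at hc
  simp only [side, hx, hy]
  exact hc.symm

theorem follows_side (f : Z.F) (x : Letter g) : Z.Follows (side f x) (side f x.next) := by
  refine ⟨?_, by rw [letter_side, letter_side]⟩
  have hx := x.rank_lt
  have hlen := bdry_length f
  have hnext := x.rank_next
  rcases Nat.lt_or_ge (x.rank + 1) (4 * g) with h | h
  · rw [Nat.mod_eq_of_lt h] at hnext
    simp only [side, hnext]
    exact List.isChain_iff_getElem.1 (Z.bdry_isPath f) x.rank (by omega)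
  · rw [show x.rank + 1 = 4 * g by omega, Nat.mod_self] at hnext
    exact dtgt_bdry_last f x x.next (by omega) hnext

theorem LeftOf.exists_follows {f : Z.F} {d : Z.Dart} (h : Z.LeftOf f d) : ∃ d', Z.Follows d d' :=
  ⟨_, leftOf_iff_side_eq.1 h ▸ follows_side f _⟩

theorem LeftOf.exists_follows_left {f : Z.F} {d : Z.Dart} (h : Z.LeftOf f d) :
    ∃ d', Z.Follows d' d := by
  obtain ⟨x, hx⟩ := Letter.next_surjective (Z.letter d)
  have hfollows := follows_side f x
  rw [hx, leftOf_iff_side_eq.1 h] at hfollows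
  exact ⟨_, hfollows⟩

theorem LeftOf.of_follows {f : Z.F} {d d' : Z.Dart} (h : Z.LeftOf f d) (hd : Z.Follows d d') :
    Z.LeftOf f d' := by
  have hfollows := follows_side f (Z.letter d)
  rw [leftOf_iff_side_eq.1 h] at hfollows
  exact hd.right_unique hfollows ▸ leftOf_side f _

theorem LeftOf.of_follows_left {f : Z.F} {d d' : Z.Dart} (h : Z.LeftOf f d')
    (hd : Z.Follows d d') : Z.LeftOf f d := by
  have hfollows := follows_side f (Z.letter d)
  rw [hd.2, leftOf_iff_side_eq.1 h] at hfollows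
  exact hd.left_unique hfollows ▸ leftOf_side f _

variable (Z) in
/-- The `4g`-gon `f` is on the left of every dart of the path `p`. -/
def LeftOfPath (f : Z.F) (p : List Z.Dart) : Prop :=
  ∀ d ∈ p, Z.LeftOf f d

theorem LeftOf.leftOfPath {f : Z.F} {p : List Z.Dart} {d : Z.Dart} (h : Z.LeftOf f d)
    (hd : d ∈ p) (hp : p.IsChain Z.Follows) : Z.LeftOfPath f p := by
  induction p generalizing d with
  | nil => cases hd
  | cons a p ih =>
    rw [List.isChain_cons] at hp
    have ha : Z.LeftOf f a := by
      rcases List.mem_cons.1 hd with rfl | hd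
      · exact h
      · exact (ih h hd hp.2 _ (List.head_mem (List.ne_nil_of_mem hd))).of_follows_left
          (hp.1 _ (List.head?_eq_some_head _))
    refine List.forall_mem_cons.2 ⟨ha, ?_⟩
    cases p with
    | nil => simp
    | cons b p => exact ih (ha.of_follows (hp.1 b rfl)) List.mem_cons_self hp.2

theorem LeftOf.face_unique {f f' : Z.F} {d : Z.Dart} (h : Z.LeftOf f d) (h' : Z.LeftOf f' d) :
    f = f' := by
  apply Z.bdry_injective
  have hf' : Z.LeftOfPath f (Z.bdry f') := h.leftOfPath h' (isChain_follows_bdry f')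
  rw [← map_side_surfaceRelator f, ← Z.bdry_word f', List.map_map]
  exact (List.map_congr_left fun d' hd' => leftOf_iff_side_eq.1 (hf' d' hd')).trans
    (List.map_id _)

theorem LeftOfPath.face_unique {f f' : Z.F} {p : List Z.Dart} (h : Z.LeftOfPath f p)
    (h' : Z.LeftOfPath f' p) (hne : p ≠ []) : f = f' :=
  (h _ (List.head_mem hne)).face_unique (h' _ (List.head_mem hne))

theorem IsBoundaryDart.of_follows {d d' : Z.Dart} (h : Z.IsBoundaryDart d)
    (hd : Z.Follows d d') : Z.IsBoundaryDart d' :=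
  fun f hf => h f (hf.of_follows_left hd)

theorem IsBoundaryDart.of_follows_left {d d' : Z.Dart} (h : Z.IsBoundaryDart d')
    (hd : Z.Follows d d') : Z.IsBoundaryDart d :=
  fun f hf => h f (hf.of_follows hd)

theorem Follows.boundaryNext {d d' : Z.Dart} (h : Z.Follows d d') : Z.BoundaryNext d d' :=
  ⟨0, between_zero_iff.2 h, fun k h1 h0 => by omega⟩

theorem Between.rev_follows {d d' h : Z.Dart} (hb : Z.Between d d' 1) (hf : Z.Follows d h) :
    Z.Follows (Z.rev h) d' := by
  refine ⟨by rw [dtgt_rev, ← hf.1, hb.1], ?_⟩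
  rw [letter_rev, Letter.next, Letter.inv_inv, ← hf.2, ← hb.2.2]
  rfl

theorem Between.follows_rev {d d' h : Z.Dart} (hb : Z.Between d d' 1) (hf : Z.Follows h d') :
    Z.Follows d (Z.rev h) :=
  ⟨by rw [dsrc_rev, hf.1, hb.1], Letter.clockwise_injective (hb.2.2.trans hf.2.symm)⟩

theorem isHanging_iff {d : Z.Dart} :
    Z.IsHanging (Z.dtgt d) (Z.letter d).next ↔ ¬ ∃ h, Z.Follows d h := by
  simp only [IsHanging, Follows, eq_comm]

theorem Between.boundaryNext {d d' : Z.Dart} (hb : Z.Between d d' 1)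
    (hf : ¬ ∃ h, Z.Follows d h) : Z.BoundaryNext d d' :=
  ⟨1, hb, fun k h1 h2 => by
    obtain rfl : k = 1 := by omega
    exact isHanging_iff.2 hf⟩

theorem BoundaryNext.not_exists_follows {d d' : Z.Dart} (h : Z.BoundaryNext d d')
    (hb : Z.Between d d' 1) : ¬ ∃ h, Z.Follows d h := by
  obtain ⟨m, hm, hhanging⟩ := h
  rw [← isHanging_iff]
  rcases Nat.eq_zero_or_pos m with rfl | hm0
  · exact absurd (hb.2.2.trans hm.2.2.symm) (Letter.clockwise_ne_self _)
  · exact hhanging 1 le_rfl hm0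

theorem isBoundaryPath_append {p q : List Z.Dart} : Z.IsBoundaryPath (p ++ q) ↔
    Z.IsBoundaryPath p ∧ Z.IsBoundaryPath q ∧
      ∀ d ∈ p.getLast?, ∀ d' ∈ q.head?, Z.BoundaryNext d d' := by
  simp only [IsBoundaryPath, List.forall_mem_append, List.isChain_append]
  tauto

theorem IsBlock.isBoundaryPath {p : List Z.Dart} (hp : Z.IsBlock p)
    (h : ∀ d ∈ p, Z.IsBoundaryDart d) : Z.IsBoundaryPath p :=
  ⟨h, (isBlock_iff.1 hp).2.imp fun _ _ => Follows.boundaryNext⟩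

theorem IsBlock.exists_leftOfPath_or_isBoundaryPath {p : List Z.Dart} (hp : Z.IsBlock p) :
    (∃ f, Z.LeftOfPath f p) ∨ Z.IsBoundaryPath p := by
  by_cases h : ∃ d ∈ p, ∃ f, Z.LeftOf f d
  · obtain ⟨d, hd, f, hf⟩ := h
    exact Or.inl ⟨f, hf.leftOfPath hd (isBlock_iff.1 hp).2⟩
  · push Not at h
    exact Or.inr (hp.isBoundaryPath h)

theorem IsBlock.concat {p : List Z.Dart} {h : Z.Dart} (hp : Z.IsBlock p)
    (hf : Z.Follows (p.getLast hp.1) h) : Z.IsBlock (p ++ [h]) := by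
  refine isBlock_iff.2 ⟨by simp, List.isChain_append.2
    ⟨(isBlock_iff.1 hp).2, List.isChain_singleton _, ?_⟩⟩
  simpa [List.getLast?_eq_some_getLast hp.1] using hf

theorem IsBlock.cons {p : List Z.Dart} {h : Z.Dart} (hp : Z.IsBlock p)
    (hf : Z.Follows h (p.head hp.1)) : Z.IsBlock (h :: p) := by
  refine isBlock_iff.2 ⟨by simp, List.isChain_cons.2 ⟨?_, (isBlock_iff.1 hp).2⟩⟩
  simpa [List.head?_eq_some_head hp.1] using hf

theorem IsBoundaryPath.concat {p : List Z.Dart} {h : Z.Dart} (hp : Z.IsBoundaryPath p)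
    (hne : p ≠ []) (hf : Z.Follows (p.getLast hne) h) : Z.IsBoundaryPath (p ++ [h]) := by
  have hh : Z.IsBoundaryDart h := (hp.1 _ (List.getLast_mem hne)).of_follows hf
  refine isBoundaryPath_append.2 ⟨hp, ⟨by simpa using hh, List.isChain_singleton _⟩, ?_⟩
  simpa [List.getLast?_eq_some_getLast hne] using hf.boundaryNext

theorem Consecutive.between {p q : List Z.Dart} (h : Z.Consecutive p q) (hp : p ≠ [])
    (hq : q ≠ []) : Z.Between (p.getLast hp) (q.head hq) 1 :=
  h _ (List.getLast?_eq_some_getLast hp) _ (List.head?_eq_some_head hq)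

theorem IsBlockChain.replace_last {P : List (List Z.Dart)} {l l' : List Z.Dart}
    (h : Z.IsBlockChain (P ++ [l])) (hl' : Z.IsBlock l') (hhead : l'.head? = l.head?) :
    Z.IsBlockChain (P ++ [l']) := by
  simp only [IsBlockChain, List.forall_mem_append, List.forall_mem_singleton, List.isChain_append,
    List.isChain_singleton, Consecutive, List.head?_singleton, Option.mem_some, forall_eq',
    hhead] at h ⊢
  exact ⟨⟨h.1.1, hl'⟩, h.2⟩

theorem IsBlockChain.replace_head {R : List (List Z.Dart)} {l l' : List Z.Dart}
    (h : Z.IsBlockChain (l :: R)) (hl' : Z.IsBlock l') (hlast : l'.getLast? = l.getLast?) :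
    Z.IsBlockChain (l' :: R) := by
  simp only [IsBlockChain, List.forall_mem_cons, List.isChain_cons, Consecutive, hlast] at h ⊢
  exact ⟨⟨hl', h.1.2⟩, h.2⟩

end Darts

/-! ### Long blocks and long chains in a boundary reduced surface -/

section BoundaryReduced

variable (Z : TiledSurface.{u} g)

/-- Consecutive blocks of lengths `2g, 2g-1, …, 2g-1` that form a boundary path: what a long chain
contained in the boundary would start with. -/
structure IsOpenBoundaryChain (B : List (List Z.Dart)) : Prop where
  isBlockChain : Z.IsBlockChain B
  exists_map_length : ∃ m, B.map List.length = 2 * g :: List.replicate m (2 * g - 1)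
  isBoundaryPath : Z.IsBoundaryPath B.flatten

variable {Z}

theorem IsOpenBoundaryChain.not_follows (hZ : Z.BoundaryReduced) {P : List (List Z.Dart)}
    {l : List Z.Dart} (hP : Z.IsOpenBoundaryChain (P ++ [l])) (hl : l ≠ []) (h : Z.Dart) :
    ¬ Z.Follows (l.getLast hl) h := by
  intro hf
  have hblock : Z.IsBlock (l ++ [h]) := (hP.isBlockChain.1 l (by simp)).concat hf
  have hboundary : Z.IsBoundaryPath (P ++ [l ++ [h]]).flatten := by
    have := hP.isBoundaryPath.concat (h := h) (by simp [hl])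
    simp only [List.flatten_append, List.flatten_singleton,
      List.getLast_append_of_ne_nil _ hl, List.append_assoc] at this ⊢
    exact this hf
  obtain ⟨m, hm⟩ := hP.exists_map_length
  cases P with
  | nil =>
    refine (hZ _ hboundary).1 ⟨by simpa using hblock, ?_⟩
    simp at hm ⊢
    omega
  | cons p P =>
    simp only [List.cons_append, List.map_cons, List.map_append, List.map_nil,
      List.cons.injEq] at hm
    cases m with
    | zero => simp at hm
    | succ m =>
      rw [List.replicate_succ'] at hm
      obtain ⟨hinit, hlast⟩ := List.append_inj' hm.2 rfl
      have hlen : (l ++ [h]).length = 2 * g := by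
        have := List.length_pos_of_ne_nil hl
        simp at hlast ⊢
        omega
      refine (hZ _ hboundary).2 ⟨_, m, rfl, hP.isBlockChain.replace_last hblock ?_, ?_⟩
      · exact List.head?_append_of_ne_nil _ hl
      · simp [hm.1, hinit, ← hlen]

theorem IsOpenBoundaryChain.isBoundaryPath_concat (hZ : Z.BoundaryReduced)
    {P : List (List Z.Dart)} {l q : List Z.Dart} (hP : Z.IsOpenBoundaryChain (P ++ [l]))
    (hq : Z.IsBlock q) (hlq : Z.Consecutive l q) :
    Z.IsBoundaryPath (P ++ [l] ++ [q]).flatten := by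
  have hl : l ≠ [] := (hP.isBlockChain.1 l (by simp)).1
  have hbetween := hlq.between hl hq.1
  have hq_boundary : Z.IsBoundaryPath q := by
    refine hq.exists_leftOfPath_or_isBoundaryPath.resolve_left fun ⟨f, hf⟩ => ?_
    obtain ⟨h, hh⟩ := (hf _ (List.head_mem hq.1)).exists_follows_left
    exact hP.not_follows hZ hl _ (hbetween.follows_rev hh)
  have hnext := hbetween.boundaryNext fun ⟨h, hh⟩ => hP.not_follows hZ hl h hh
  rw [List.flatten_append, isBoundaryPath_append]
  refine ⟨hP.isBoundaryPath, by simpa using hq_boundary, ?_⟩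
  simpa [List.getLast?_append_of_ne_nil _ hl, List.getLast?_eq_some_getLast hl,
    List.head?_eq_some_head hq.1] using hnext

theorem IsOpenBoundaryChain.not_isBlockChain_append (hZ : Z.BoundaryReduced) (k : ℕ) :
    ∀ {P R : List (List Z.Dart)} {l : List Z.Dart}, Z.IsOpenBoundaryChain (P ++ [l]) →
      R.map List.length = List.replicate k (2 * g - 1) ++ [2 * g] →
      ¬ Z.IsBlockChain (P ++ [l] ++ R) := by
  induction k with
  | zero =>
    intro P R l hP hR hB
    obtain ⟨q, R, rfl, hq, hR⟩ := List.map_eq_cons_iff.1 hR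
    obtain rfl := List.map_eq_nil_iff.1 hR
    obtain ⟨m, hm⟩ := hP.exists_map_length
    have hlq : Z.Consecutive l q := (List.isChain_append.1 hB.2).2.2 l (by simp) q (by simp)
    refine (hZ _ (hP.isBoundaryPath_concat hZ (hB.1 q (by simp)) hlq)).2 ⟨_, m, rfl, hB, ?_⟩
    rw [List.map_append, hm, List.map_singleton, hq, List.cons_append]
  | succ k ih =>
    intro P R l hP hR hB
    obtain ⟨q, R, rfl, hq, hR⟩ := List.map_eq_cons_iff.1 hR
    obtain ⟨m, hm⟩ := hP.exists_map_length
    have hlq : Z.Consecutive l q := (List.isChain_append.1 hB.2).2.2 l (by simp) q (by simp)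
    have hqblock : Z.IsBlock q := hB.1 q (by simp)
    rw [List.append_cons] at hB
    refine ih ⟨⟨fun p hp => hB.1 p (List.mem_append_left _ hp), hB.2.left_of_append⟩,
      ⟨m + 1, ?_⟩, hP.isBoundaryPath_concat hZ hqblock hlq⟩ hR hB
    rw [List.map_append, hm, List.map_singleton, hq, List.replicate_succ', List.cons_append]

theorem BoundaryReduced.exists_leftOfPath_of_isLongBlock (hZ : Z.BoundaryReduced)
    {p : List Z.Dart} (hp : Z.IsLongBlock p) : ∃ f, Z.LeftOfPath f p :=
  hp.1.exists_leftOfPath_or_isBoundaryPath.resolve_right fun h => (hZ p h).1 hp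

theorem IsBlock.exists_cons_of_consecutive {l q : List Z.Dart} {f : Z.F} (hl : l ≠ [])
    (hf : Z.LeftOfPath f l) (hq : Z.IsBlock q) (hlq : Z.Consecutive l q)
    (hboundary : Z.IsBoundaryPath q) : ∃ h, Z.IsBlock (h :: q) ∧ Z.IsBoundaryPath (h :: q) := by
  obtain ⟨h, hh⟩ := (hf _ (List.getLast_mem hl)).exists_follows
  have hrev := (hlq.between hl hq.1).rev_follows hh
  have hblock := hq.cons hrev
  exact ⟨Z.rev h, hblock, hblock.isBoundaryPath (List.forall_mem_cons.2
    ⟨(hboundary.1 _ (List.head_mem hq.1)).of_follows_left hrev, hboundary.1⟩)⟩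

theorem BoundaryReduced.exists_leftOfPath_of_isBlockChain_cons (hZ : Z.BoundaryReduced) (k : ℕ) :
    ∀ {l : List Z.Dart} {R : List (List Z.Dart)} {f : Z.F}, Z.LeftOfPath f l →
      R.map List.length = List.replicate k (2 * g - 1) ++ [2 * g] →
      Z.IsBlockChain (l :: R) → ∀ q ∈ R, ∃ f, Z.LeftOfPath f q := by
  induction k with
  | zero =>
    intro l R f hf hR hB
    obtain ⟨q, R, rfl, hq, hR⟩ := List.map_eq_cons_iff.1 hR
    obtain rfl := List.map_eq_nil_iff.1 hR
    have hqblock : Z.IsBlock q := hB.1 q (by simp)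
    refine List.forall_mem_singleton.2
      (hqblock.exists_leftOfPath_or_isBoundaryPath.resolve_right fun hboundary => ?_)
    obtain ⟨h, hblock, hpath⟩ := hqblock.exists_cons_of_consecutive (hB.1 l (by simp)).1 hf
      (List.isChain_cons_cons.1 hB.2).1 hboundary
    exact (hZ _ hpath).1 ⟨hblock, by rw [List.length_cons, hq]⟩
  | succ k ih =>
    intro l R f hf hR hB
    obtain ⟨q, R, rfl, hq, hR⟩ := List.map_eq_cons_iff.1 hR
    have hqblock : Z.IsBlock q := hB.1 q (by simp)
    obtain ⟨hlq, hchain⟩ := List.isChain_cons_cons.1 hB.2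
    have htail : Z.IsBlockChain (q :: R) := ⟨(List.forall_mem_cons.1 hB.1).2, hchain⟩
    obtain ⟨f', hf'⟩ : ∃ f', Z.LeftOfPath f' q := by
      refine hqblock.exists_leftOfPath_or_isBoundaryPath.resolve_right fun hboundary => ?_
      obtain ⟨h, hblock, hpath⟩ := hqblock.exists_cons_of_consecutive (hB.1 l (by simp)).1 hf
        hlq hboundary
      have hlen : (h :: q).length = 2 * g := by
        have := List.length_pos_of_ne_nil hqblock.1
        rw [List.length_cons]
        omega
      refine IsOpenBoundaryChain.not_isBlockChain_append hZ k (P := []) (l := h :: q)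
        ⟨⟨by simpa using hblock, List.isChain_singleton _⟩, ⟨0, by simpa using hlen⟩,
          by simpa using hpath⟩ hR (htail.replace_head hblock ?_)
      exact List.getLast?_cons_of_ne_nil hqblock.1
    exact List.forall_mem_cons.2 ⟨⟨f', hf'⟩, ih hf' hR htail⟩

theorem BoundaryReduced.exists_leftOfPath_of_isBlockChain (hZ : Z.BoundaryReduced)
    {B : List (List Z.Dart)} {k : ℕ} (hB : Z.IsBlockChain B)
    (hlen : B.map List.length = 2 * g :: (List.replicate k (2 * g - 1) ++ [2 * g])) :
    ∀ q ∈ B, ∃ f, Z.LeftOfPath f q := by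
  obtain ⟨q, R, rfl, hq, hR⟩ := List.map_eq_cons_iff.1 hlen
  have hqblock : Z.IsBlock q := hB.1 q (by simp)
  obtain ⟨f, hf⟩ : ∃ f, Z.LeftOfPath f q := by
    refine hqblock.exists_leftOfPath_or_isBoundaryPath.resolve_right fun hboundary => ?_
    exact IsOpenBoundaryChain.not_isBlockChain_append hZ k (P := []) (l := q)
      ⟨⟨by simpa using hqblock, List.isChain_singleton _⟩, ⟨0, by simpa using hq⟩,
        by simpa using hboundary⟩ hR hB
  exact List.forall_mem_cons.2
    ⟨⟨f, hf⟩, hZ.exists_leftOfPath_of_isBlockChain_cons k hf hR hB⟩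

end BoundaryReduced

/-! ### Morphisms and sub-complexes -/

namespace Hom

variable {Y : TiledSurface.{u} g} {Z : TiledSurface.{v} g} (φ : Hom Y Z)

/-- The action of a morphism on darts. -/
def onDart (d : Y.Dart) : Z.Dart := (φ.onE d.1, d.2)

theorem dsrc_onDart (d : Y.Dart) : Z.dsrc (φ.onDart d) = φ.onV (Y.dsrc d) := by
  rcases d with ⟨e, _ | _⟩
  · exact φ.tgt_onE e
  · exact φ.src_onE e

theorem dtgt_onDart (d : Y.Dart) : Z.dtgt (φ.onDart d) = φ.onV (Y.dtgt d) := by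
  rcases d with ⟨e, _ | _⟩
  · exact φ.src_onE e
  · exact φ.tgt_onE e

theorem letter_onDart (d : Y.Dart) : Z.letter (φ.onDart d) = Y.letter d :=
  Prod.ext (φ.label_onE d.1) rfl

theorem between_onDart {d d' : Y.Dart} {m : ℕ} (h : Y.Between d d' m) :
    Z.Between (φ.onDart d) (φ.onDart d') m :=
  ⟨by rw [dtgt_onDart, dsrc_onDart, h.1], h.2.1, by rw [letter_onDart, letter_onDart, h.2.2]⟩

theorem isBlock_map {p : List Y.Dart} (hp : Y.IsBlock p) : Z.IsBlock (p.map φ.onDart) :=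
  ⟨mt List.map_eq_nil_iff.1 hp.1,
    (List.isChain_map _).2 (hp.2.imp fun _ _ => φ.between_onDart)⟩

theorem consecutive_map {p q : List Y.Dart} (h : Y.Consecutive p q) :
    Z.Consecutive (p.map φ.onDart) (q.map φ.onDart) := by
  intro d hd d' hd'
  simp only [List.getLast?_map, List.head?_map, Option.mem_def, Option.map_eq_some_iff] at hd hd'
  obtain ⟨d, hd, rfl⟩ := hd
  obtain ⟨d', hd', rfl⟩ := hd'
  exact φ.between_onDart (h d hd d' hd')

theorem isBlockChain_map {B : List (List Y.Dart)} (hB : Y.IsBlockChain B) :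
    Z.IsBlockChain (B.map (List.map φ.onDart)) :=
  ⟨List.forall_mem_map.2 fun p hp => φ.isBlock_map (hB.1 p hp),
    (List.isChain_map _).2 (hB.2.imp fun _ _ => φ.consecutive_map)⟩

theorem exists_leftOfPath_of_isLongBlock (hZ : Z.BoundaryReduced) {p : List Y.Dart}
    (hp : Y.IsLongBlock p) : ∃ f, Z.LeftOfPath f (p.map φ.onDart) :=
  hZ.exists_leftOfPath_of_isLongBlock ⟨φ.isBlock_map hp.1, by simpa using hp.2⟩

theorem exists_leftOfPath_of_isBlockChain (hZ : Z.BoundaryReduced) {B : List (List Y.Dart)}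
    {k : ℕ} (hB : Y.IsBlockChain B)
    (hlen : B.map List.length = 2 * g :: (List.replicate k (2 * g - 1) ++ [2 * g])) :
    ∀ q ∈ B, ∃ f, Z.LeftOfPath f (q.map φ.onDart) := by
  intro q hq
  refine hZ.exists_leftOfPath_of_isBlockChain (k := k) (φ.isBlockChain_map hB) ?_ _
    (List.mem_map_of_mem hq)
  simpa [Function.comp_def] using hlen

theorem exists_leftOf_onDart (hZ : Z.BoundaryReduced) {p : List Y.Dart}
    (hp : Y.IsLongBlock p ∨ Y.IsLongChain p) : ∀ d ∈ p, ∃ f, Z.LeftOf f (φ.onDart d) := by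
  intro d hd
  rcases hp with hp | ⟨B, k, rfl, hB, hlen⟩
  · obtain ⟨f, hf⟩ := φ.exists_leftOfPath_of_isLongBlock hZ hp
    exact ⟨f, hf _ (List.mem_map_of_mem hd)⟩
  · obtain ⟨q, hq, hdq⟩ := List.mem_flatten.1 hd
    obtain ⟨f, hf⟩ := φ.exists_leftOfPath_of_isBlockChain hZ hB hlen q hq
    exact ⟨f, hf _ (List.mem_map_of_mem hdq)⟩

theorem isCompact_range (hY : Y.IsCompact) : φ.range.toTiledSurface.IsCompact := by
  obtain ⟨_, _, _⟩ := hY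
  exact ⟨Set.finite_range φ.onV, Set.finite_range φ.onE, Set.finite_range φ.onF⟩

end Hom

namespace Subcomplex

variable {Z : TiledSurface.{u} g}

instance : PartialOrder (Subcomplex Z) where
  le_refl _ := ⟨subset_rfl, subset_rfl, subset_rfl⟩
  le_trans _ _ _ h h' := ⟨h.1.trans h'.1, h.2.1.trans h'.2.1, h.2.2.trans h'.2.2⟩
  le_antisymm _ _ h h' :=
    Subcomplex.ext (h.1.antisymm h'.1) (h.2.1.antisymm h'.2.1) (h.2.2.antisymm h'.2.2)

theorem inter_eq_of_isLeast {S : Set (Subcomplex Z)} {X : Subcomplex Z} (h : IsLeast S X) :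
    inter S = X := by
  have inter_le : inter S ≤ X := ⟨fun _ hv => hv X h.1, fun _ he => he X h.1, fun _ hf => hf X h.1⟩
  have le_inter : X ≤ inter S := ⟨fun _ hv _ hW => (h.2 hW).1 hv,
    fun _ he _ hW => (h.2 hW).2.1 he, fun _ hf _ hW => (h.2 hW).2.2 hf⟩
  exact le_antisymm inter_le le_inter

/-- The inclusion of a sub-complex in the ambient tiled surface. -/
def incl (X : Subcomplex Z) : Hom X.toTiledSurface Z where
  onV := Subtype.val
  onE := Subtype.val
  onF := Subtype.val
  src_onE _ := rfl
  tgt_onE _ := rfl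
  label_onE _ := rfl
  bdry_onF f := (X.map_subBdry f).symm

theorem toAmbient_injective (X : Subcomplex Z) : Function.Injective X.toAmbient := fun _ _ h =>
  Prod.ext (Subtype.ext (Prod.ext_iff.1 h).1) (Prod.ext_iff.1 h).2

/-- The inclusion of a sub-complex in a larger one. -/
def inclOfLE {X W : Subcomplex Z} (h : X ≤ W) : Hom X.toTiledSurface W.toTiledSurface where
  onV := Set.inclusion h.1
  onE := Set.inclusion h.2.1
  onF := Set.inclusion h.2.2
  src_onE _ := rfl
  tgt_onE _ := rfl
  label_onE _ := rfl
  bdry_onF f := by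
    apply List.map_injective_iff.2 W.toAmbient_injective
    refine (W.map_subBdry _).trans ((X.map_subBdry f).symm.trans ?_)
    exact (List.map_map (f := Prod.map (Set.inclusion h.2.1) id) (g := W.toAmbient)).symm

theorem leftOf_iff (X : Subcomplex Z) {f : X.faces} {d : X.toTiledSurface.Dart} :
    X.toTiledSurface.LeftOf f d ↔ Z.LeftOf f.1 (X.toAmbient d) := by
  change d ∈ X.subBdry f ↔ X.toAmbient d ∈ Z.bdry f.1
  rw [← X.map_subBdry f]
  exact (List.mem_map_of_injective X.toAmbient_injective).symm

theorem le_adjoin (X : Subcomplex Z) (S : Set Z.F) : X ≤ X.adjoin S :=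
  ⟨Set.subset_union_left, Set.subset_union_left, Set.subset_union_left⟩

theorem adjoin_le {X W : Subcomplex Z} {S : Set Z.F} (h : X ≤ W) (hS : S ⊆ W.faces) :
    X.adjoin S ≤ W := by
  refine ⟨Set.union_subset h.1 ?_, Set.union_subset h.2.1 ?_, Set.union_subset h.2.2 hS⟩
  · rintro v ⟨f, hf, d, hd, rfl | rfl⟩
    · exact W.src_mem _ (W.bdry_mem f (hS hf) d hd)
    · exact W.tgt_mem _ (W.bdry_mem f (hS hf) d hd)
  · rintro e ⟨f, hf, d, hd, rfl⟩
    exact W.bdry_mem f (hS hf) d hd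

theorem facesAlong_subset {X W : Subcomplex Z} (h : X ≤ W)
    (hW : W.toTiledSurface.BoundaryReduced) {p : List X.toTiledSurface.Dart}
    (hp : X.toTiledSurface.IsLongBlock p ∨ X.toTiledSurface.IsLongChain p) :
    X.facesAlong p ⊆ W.faces := by
  rintro f ⟨d, hd, hf⟩
  obtain ⟨f', hf'⟩ := (inclOfLE h).exists_leftOf_onDart hW hp d hd
  rw [hf.face_unique (W.leftOf_iff.1 hf')]
  exact f'.2

theorem Step.le_iff {X X' W : Subcomplex Z} (h : X.Step X')
    (hW : W.toTiledSurface.BoundaryReduced) : X' ≤ W ↔ X ≤ W := by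
  obtain ⟨p, -, hp, rfl⟩ := h
  exact ⟨(X.le_adjoin _).trans, fun hXW => adjoin_le hXW (facesAlong_subset hXW hW hp)⟩

theorem finite_facesAlong (X : Subcomplex Z) (p : List X.toTiledSurface.Dart) :
    (X.facesAlong p).Finite := by
  have : X.facesAlong p = ⋃ d ∈ {d | d ∈ p}, {f | Z.LeftOf f (X.toAmbient d)} := by
    ext f
    simp [facesAlong]
  rw [this]
  exact (List.finite_toSet p).biUnion fun d _ =>
    Set.Subsingleton.finite fun _ hf _ hf' => hf.face_unique hf'

theorem isCompact_iff (X : Subcomplex Z) :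
    X.toTiledSurface.IsCompact ↔ X.verts.Finite ∧ X.edges.Finite ∧ X.faces.Finite := Iff.rfl

theorem isCompact_adjoin {X : Subcomplex Z} (hX : X.toTiledSurface.IsCompact) {S : Set Z.F}
    (hS : S.Finite) : (X.adjoin S).toTiledSurface.IsCompact := by
  rw [isCompact_iff] at hX ⊢
  have hsides : {d | ∃ f ∈ S, d ∈ Z.bdry f}.Finite := by
    refine (hS.biUnion fun f _ => (Z.bdry f).finite_toSet).subset fun d ⟨f, hf, hd⟩ => ?_
    exact Set.mem_biUnion hf hd
  refine ⟨hX.1.union ?_, hX.2.1.union ?_, hX.2.2.union hS⟩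
  · refine ((hsides.image fun d => Z.src d.1).union (hsides.image fun d => Z.tgt d.1)).subset ?_
    rintro v ⟨f, hf, d, hd, rfl | rfl⟩
    · exact Or.inl ⟨d, ⟨f, hf, hd⟩, rfl⟩
    · exact Or.inr ⟨d, ⟨f, hf, hd⟩, rfl⟩
  · refine (hsides.image Prod.fst).subset ?_
    rintro e ⟨f, hf, d, hd, rfl⟩
    exact ⟨d, ⟨f, hf, hd⟩, rfl⟩

theorem Step.isCompact {X X' : Subcomplex Z} (h : X.Step X') (hX : X.toTiledSurface.IsCompact) :
    X'.toTiledSurface.IsCompact := by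
  obtain ⟨p, -, -, rfl⟩ := h
  exact isCompact_adjoin hX (X.finite_facesAlong p)

/-! ### The length of the boundary -/

/-- The darts of the ambient tiled surface that run along the boundary of a sub-complex. -/
def boundaryDarts (X : Subcomplex Z) : Set Z.Dart :=
  {d | d.1 ∈ X.edges ∧ ∀ f ∈ X.faces, ¬ Z.LeftOf f d}

theorem boundaryLength_eq_ncard (X : Subcomplex Z) :
    X.toTiledSurface.boundaryLength = X.boundaryDarts.ncard := by
  refine (Set.ncard_image_of_injective {d : X.toTiledSurface.Dart |
    X.toTiledSurface.IsBoundaryDart d} X.toAmbient_injective).symm.trans (congrArg Set.ncard ?_)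
  ext d
  constructor
  · rintro ⟨d, hd, rfl⟩
    exact ⟨d.1.2, fun f hf hl => hd ⟨f, hf⟩ (X.leftOf_iff.2 hl)⟩
  · rintro ⟨hd, hf⟩
    exact ⟨(⟨d.1, hd⟩, d.2), fun f hl => hf f.1 f.2 (X.leftOf_iff.1 hl), rfl⟩

/-- The dart `d` either belongs to `X` or has on its right a `4g`-gon of `S`, so that adding
a `4g`-gon on its left together with `S` to `X` does not expose the edge of `d`. -/
def IsCovered (X : Subcomplex Z) (S : Set Z.F) (d : Z.Dart) : Prop :=
  d.1 ∈ X.edges ∨ ∃ f ∈ S, Z.LeftOf f (Z.rev d)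

open scoped Classical in
/-- The sides of the `4g`-gon `f` that belong to `X`. -/
noncomputable def oldSides (X : Subcomplex Z) (f : Z.F) : Finset Z.Dart :=
  (Z.bdry f).toFinset.filter fun d => d.1 ∈ X.edges

open scoped Classical in
/-- The sides of the `4g`-gon `f` whose reverses run along the boundary after `f`, along with the
other `4g`-gons of `S`, has been added to `X`. -/
noncomputable def exposedSides (X : Subcomplex Z) (S : Set Z.F) (f : Z.F) : Finset Z.Dart :=
  (Z.bdry f).toFinset.filter fun d => ¬ X.IsCovered S d

theorem mem_oldSides {X : Subcomplex Z} {f : Z.F} {d : Z.Dart} :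
    d ∈ X.oldSides f ↔ Z.LeftOf f d ∧ d.1 ∈ X.edges := by
  simp only [oldSides, Finset.mem_filter, List.mem_toFinset, LeftOf.eq_def]

theorem mem_exposedSides {X : Subcomplex Z} {S : Set Z.F} {f : Z.F} {d : Z.Dart} :
    d ∈ X.exposedSides S f ↔ Z.LeftOf f d ∧ ¬ X.IsCovered S d := by
  simp only [exposedSides, Finset.mem_filter, List.mem_toFinset, LeftOf.eq_def]

theorem boundaryDarts_adjoin_subset (X : Subcomplex Z) (S : Set Z.F) :
    (X.adjoin S).boundaryDarts ⊆
      (X.boundaryDarts \ ⋃ f ∈ S, X.oldSides f) ∪ Z.rev '' ⋃ f ∈ S, X.exposedSides S f := by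
  rintro d ⟨hd, hboundary⟩
  by_cases hdX : d.1 ∈ X.edges
  · refine Or.inl ⟨⟨hdX, fun f hf => hboundary f (Or.inl hf)⟩, ?_⟩
    simp only [Set.mem_iUnion, Finset.mem_coe, mem_oldSides]
    exact fun ⟨f, hf, hl, _⟩ => hboundary f (Or.inr hf) hl
  · obtain ⟨f, hf, d', hd', hedge⟩ := hd.resolve_left hdX
    obtain rfl : d' = Z.rev d := by
      rcases Bool.eq_or_eq_not d'.2 d.2 with hsign | hsign
      · obtain rfl : d' = d := Prod.ext hedge.symm hsign
        exact absurd hd' (hboundary f (Or.inr hf))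
      · exact Prod.ext hedge.symm hsign
    refine Or.inr ⟨Z.rev d, ?_, rev_rev d⟩
    simp only [Set.mem_iUnion, Finset.mem_coe, mem_exposedSides, IsCovered, rev_rev, not_or]
    exact ⟨f, hf, hd', hdX, fun ⟨f', hf', hl⟩ => hboundary f' (Or.inr hf') hl⟩

theorem boundaryLength_adjoin_add_le {X : Subcomplex Z} (hX : X.edges.Finite) {S : Finset Z.F}
    (hS : ∀ f ∈ S, f ∉ X.faces) :
    (X.adjoin S).toTiledSurface.boundaryLength + ∑ f ∈ S, (X.oldSides f).card ≤
      X.toTiledSurface.boundaryLength + ∑ f ∈ S, (X.exposedSides S f).card := by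
  classical
  set old := S.biUnion X.oldSides with hold
  set exposed := S.biUnion (X.exposedSides S) with hexposed
  have hfin : X.boundaryDarts.Finite :=
    (hX.prod (Set.finite_univ (α := Bool))).subset fun d hd => ⟨hd.1, trivial⟩
  have old_subset : (old : Set Z.Dart) ⊆ X.boundaryDarts := by
    intro d hd
    obtain ⟨f, hf, hd⟩ := Finset.mem_biUnion.1 hd
    obtain ⟨hl, hd⟩ := mem_oldSides.1 hd
    exact ⟨hd, fun f' hf' hl' => hS f hf (hl.face_unique hl' ▸ hf')⟩
  have card_old : old.card = ∑ f ∈ S, (X.oldSides f).card :=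
    Finset.card_biUnion fun f _ f' _ hne => Finset.disjoint_left.2 fun d hd hd' =>
      hne ((mem_oldSides.1 hd).1.face_unique (mem_oldSides.1 hd').1)
  have card_exposed : (exposed.image Z.rev).card ≤ ∑ f ∈ S, (X.exposedSides S f).card :=
    Finset.card_image_le.trans Finset.card_biUnion_le
  have adjoin_subset : (X.adjoin S).boundaryDarts ⊆
      (X.boundaryDarts \ old) ∪ (exposed.image Z.rev : Finset Z.Dart) := by
    simpa [hold, hexposed] using X.boundaryDarts_adjoin_subset S
  have card_sdiff := Set.ncard_sdiff_add_ncard_of_subset old_subset hfin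
  have card_union := (Set.ncard_le_ncard adjoin_subset
    ((hfin.subset Set.sdiff_subset).union (Finset.finite_toSet _))).trans (Set.ncard_union_le _ _)
  rw [Set.ncard_coe_finset] at card_sdiff card_union
  rw [boundaryLength_eq_ncard, boundaryLength_eq_ncard]
  omega

open scoped Classical in
theorem boundaryLength_adjoin_add_two_le {X : Subcomplex Z} (hX : X.edges.Finite) {S : Set Z.F}
    (hfin : S.Finite) (hS : ∀ f ∈ S, f ∉ X.faces) {f₀ f₁ : Z.F} (hf₀ : f₀ ∈ S) (hf₁ : f₁ ∈ S)
    (hcard : ∀ f ∈ S, (X.exposedSides S f).card + ((if f = f₀ then 1 else 0) +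
      if f = f₁ then 1 else 0) ≤ (X.oldSides f).card) :
    (X.adjoin S).toTiledSurface.boundaryLength + 2 ≤ X.toTiledSurface.boundaryLength := by
  lift S to Finset Z.F using hfin
  have hle := boundaryLength_adjoin_add_le hX hS
  have hsum := Finset.sum_le_sum hcard
  simp only [Finset.sum_add_distrib, Finset.sum_ite_eq', if_pos (Finset.mem_coe.1 hf₀),
    if_pos (Finset.mem_coe.1 hf₁)] at hsum
  omega

theorem length_le_card_oldSides {X : Subcomplex Z} {f : Z.F} {L : List Z.Dart} (hL : L.Nodup)
    (hf : Z.LeftOfPath f L) (hX : ∀ d ∈ L, d.1 ∈ X.edges) : L.length ≤ (X.oldSides f).card := by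
  classical
  rw [← List.toFinset_card_of_nodup hL]
  refine Finset.card_le_card fun d hd => ?_
  rw [List.mem_toFinset] at hd
  exact mem_oldSides.2 ⟨hf d hd, hX d hd⟩

theorem card_exposedSides_add_length_le {X : Subcomplex Z} {S : Set Z.F} {f : Z.F}
    {L : List Z.Dart} (hL : L.Nodup) (hf : Z.LeftOfPath f L) (hX : ∀ d ∈ L, X.IsCovered S d) :
    (X.exposedSides S f).card + L.length ≤ 4 * g := by
  classical
  have hdisjoint : Disjoint (X.exposedSides S f) L.toFinset :=
    Finset.disjoint_left.2 fun d hd hdL =>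
      (mem_exposedSides.1 hd).2 (hX d (List.mem_toFinset.1 hdL))
  rw [← List.toFinset_card_of_nodup hL, ← Finset.card_union_of_disjoint hdisjoint, ← bdry_length f]
  refine (Finset.card_le_card (Finset.union_subset (Finset.filter_subset _ _) fun d hd => ?_)).trans
    (List.toFinset_card_le _)
  exact List.mem_toFinset.2 (hf d (List.mem_toFinset.1 hd))

theorem card_exposedSides_lt {X : Subcomplex Z} {S : Set Z.F} {f : Z.F} {L : List Z.Dart}
    (hL : L.IsChain Z.Follows) (hlen : L.length = 2 * g + 1) (hf : Z.LeftOfPath f L)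
    (hX : ∀ d ∈ L, X.IsCovered S d) : (X.exposedSides S f).card < 2 * g := by
  have hpos : 0 < g := (Z.letter (L.head (List.ne_nil_of_length_pos (by omega)))).genus_pos
  have := card_exposedSides_add_length_le (nodup_of_isChain_follows hL (by omega)) hf hX
  omega

/-- The block `Q` of the ambient tiled surface can be prolonged by a dart outside `X` that is not
exposed when the `4g`-gons of `S` are added to `X`. -/
def HasInnerNext (X : Subcomplex Z) (S : Set Z.F) (Q : List Z.Dart) : Prop :=
  ∃ h, h.1 ∉ X.edges ∧ X.IsCovered S h ∧ (Q ++ [h]).IsChain Z.Follows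

/-- The block `Q` of the ambient tiled surface can be prolonged backwards by a dart outside `X`
that is not exposed when the `4g`-gons of `S` are added to `X`. -/
def HasInnerPrev (X : Subcomplex Z) (S : Set Z.F) (Q : List Z.Dart) : Prop :=
  ∃ h, h.1 ∉ X.edges ∧ X.IsCovered S h ∧ (h :: Q).IsChain Z.Follows

section Count

variable {X : Subcomplex Z} {S : Set Z.F} {f : Z.F} {Q : List Z.Dart}

theorem card_exposedSides_le (hX : ∀ d ∈ Q, d.1 ∈ X.edges) (hlen : Q.length = 2 * g - 1)
    (hf : Z.LeftOfPath f Q) (hnext : X.HasInnerNext S Q) (hprev : X.HasInnerPrev S Q) :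
    (X.exposedSides S f).card ≤ (X.oldSides f).card := by
  obtain ⟨h, -, hcov, hchain⟩ := hnext
  obtain ⟨h', -, hcov', hchain'⟩ := hprev
  have hpos := (Z.letter h).genus_pos
  obtain ⟨d, hd⟩ := List.exists_mem_of_length_pos (l := Q) (by omega)
  have hlong : (h' :: (Q ++ [h])).IsChain Z.Follows := by
    rw [List.isChain_cons] at hchain' ⊢
    rw [List.head?_append_of_ne_nil _ (List.ne_nil_of_mem hd)]
    exact ⟨hchain'.1, hchain⟩
  have hlt : (X.exposedSides S f).card < 2 * g := by
    refine card_exposedSides_lt hlong (by simp; omega)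
      ((hf d hd).leftOfPath (by simp [hd]) hlong) ?_
    simp only [List.forall_mem_cons, List.forall_mem_append, List.not_mem_nil]
    exact ⟨hcov', fun d hd => Or.inl (hX d hd), hcov, nofun⟩
  have hle := length_le_card_oldSides
    (nodup_of_isChain_follows hchain'.of_cons (by omega)) hf hX
  omega

theorem two_mul_le_card_oldSides (hX : ∀ d ∈ Q, d.1 ∈ X.edges) (hlen : Q.length = 2 * g)
    (hf : Z.LeftOfPath f Q) (hchain : Q.IsChain Z.Follows) : 2 * g ≤ (X.oldSides f).card :=
  hlen ▸ length_le_card_oldSides (nodup_of_isChain_follows hchain (by omega)) hf hX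

theorem HasInnerNext.card_exposedSides_lt (hnext : X.HasInnerNext S Q)
    (hX : ∀ d ∈ Q, d.1 ∈ X.edges) (hlen : Q.length = 2 * g) (hf : Z.LeftOfPath f Q) :
    (X.exposedSides S f).card < (X.oldSides f).card := by
  obtain ⟨h, -, hcov, hchain⟩ := hnext
  have hpos := (Z.letter h).genus_pos
  obtain ⟨d, hd⟩ := List.exists_mem_of_length_pos (l := Q) (by omega)
  refine (Subcomplex.card_exposedSides_lt hchain (by simp [hlen])
    ((hf d hd).leftOfPath (by simp [hd]) hchain) ?_).trans_le
    (two_mul_le_card_oldSides hX hlen hf hchain.left_of_append)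
  exact List.forall_mem_append.2 ⟨fun d hd => Or.inl (hX d hd), by simpa using hcov⟩

theorem HasInnerPrev.card_exposedSides_lt (hprev : X.HasInnerPrev S Q)
    (hX : ∀ d ∈ Q, d.1 ∈ X.edges) (hlen : Q.length = 2 * g) (hf : Z.LeftOfPath f Q) :
    (X.exposedSides S f).card < (X.oldSides f).card := by
  obtain ⟨h, -, hcov, hchain⟩ := hprev
  have hpos := (Z.letter h).genus_pos
  obtain ⟨d, hd⟩ := List.exists_mem_of_length_pos (l := Q) (by omega)
  refine (Subcomplex.card_exposedSides_lt hchain (by simp [hlen])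
    ((hf d hd).leftOfPath (by simp [hd]) hchain) ?_).trans_le
    (two_mul_le_card_oldSides hX hlen hf hchain.of_cons)
  exact List.forall_mem_cons.2 ⟨hcov, fun d hd => Or.inl (hX d hd)⟩

/-- If the first and the last block of a long chain lie along the same `4g`-gon, then the darts
that prolong them either differ, or both coincide with the dart between the two blocks; in each
case the `4g`-gon has `2g + 2` sides that are not exposed. -/
theorem card_exposedSides_add_two_le {Q' : List Z.Dart} (hX : ∀ d ∈ Q, d.1 ∈ X.edges)
    (hX' : ∀ d ∈ Q', d.1 ∈ X.edges) (hlen : Q.length = 2 * g) (hlen' : Q'.length = 2 * g)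
    (hf : Z.LeftOfPath f Q) (hf' : Z.LeftOfPath f Q') (hnext : X.HasInnerNext S Q)
    (hprev : X.HasInnerPrev S Q') :
    (X.exposedSides S f).card + 2 ≤ (X.oldSides f).card := by
  obtain ⟨h, -, hcov, hchain⟩ := hnext
  obtain ⟨h', hhX', hcov', hchain'⟩ := hprev
  have hpos := (Z.letter h).genus_pos
  obtain ⟨d, hd⟩ := List.exists_mem_of_length_pos (l := Q) (by omega)
  obtain ⟨e, Q', rfl⟩ := List.exists_cons_of_length_pos (l := Q') (by omega)
  have hleft : Z.LeftOfPath f (Q ++ [h]) := (hf d hd).leftOfPath (by simp [hd]) hchain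
  have hfollows : Z.Follows h' e := (List.isChain_cons_cons.1 hchain').1
  have hnodup : (Q ++ [h]).Nodup := nodup_of_isChain_follows hchain (by simp; omega)
  have hcovered : ∀ d ∈ Q ++ [h], X.IsCovered S d :=
    List.forall_mem_append.2 ⟨fun d hd => Or.inl (hX d hd), by simpa using hcov⟩
  have hold := two_mul_le_card_oldSides hX hlen hf hchain.left_of_append
  suffices ∃ x ∉ Q ++ [h], Z.LeftOf f x ∧ X.IsCovered S x by
    obtain ⟨x, hx, hxf, hxcov⟩ := this
    have hle := card_exposedSides_add_length_le (List.nodup_cons.2 ⟨hx, hnodup⟩)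
      (List.forall_mem_cons.2 ⟨hxf, hleft⟩) (List.forall_mem_cons.2 ⟨hxcov, hcovered⟩)
    simp only [List.length_cons, List.length_append, hlen, List.length_nil] at hle
    omega
  by_cases heq : h' = h
  · subst heq
    have hlong : (Q ++ [h'] ++ [e]).IsChain Z.Follows :=
      List.isChain_append.2 ⟨hchain, List.isChain_singleton _, by simpa using hfollows⟩
    have hnodup' := nodup_of_isChain_follows hlong (by simp; omega)
    exact ⟨e, fun he => (List.nodup_append.1 hnodup').2.2 e he e (by simp) rfl,
      hf' e (by simp), Or.inl (hX' e (by simp))⟩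
  · refine ⟨h', fun hmem => ?_, (hf' e (by simp)).of_follows_left hfollows, hcov'⟩
    rcases List.mem_append.1 hmem with hmem | hmem
    · exact hhX' (hX h' hmem)
    · exact heq (List.mem_singleton.1 hmem)

end Count

section Step

variable {X : Subcomplex Z}

theorem mem_edges_of_mem_map (p : List X.toTiledSurface.Dart) :
    ∀ d ∈ p.map X.incl.onDart, d.1 ∈ X.edges :=
  List.forall_mem_map.2 fun d _ => d.1.2

theorem isChain_follows_map {q : List X.toTiledSurface.Dart} (hq : X.toTiledSurface.IsBlock q) :
    (q.map X.incl.onDart).IsChain Z.Follows :=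
  (isBlock_iff.1 (X.incl.isBlock_map hq)).2

theorem notMem_faces_of_mem_facesAlong {p : List X.toTiledSurface.Dart}
    (hp : X.toTiledSurface.IsBoundaryPath p) : ∀ f ∈ X.facesAlong p, f ∉ X.faces :=
  fun f ⟨d, hd, hl⟩ hf => hp.1 d hd ⟨f, hf⟩ (X.leftOf_iff.2 hl)

theorem mem_facesAlong_flatten {B : List (List X.toTiledSurface.Dart)}
    (hB : ∀ q ∈ B, X.toTiledSurface.IsBlock q) {f : Z.F} :
    f ∈ X.facesAlong B.flatten ↔ ∃ q ∈ B, Z.LeftOfPath f (q.map X.incl.onDart) := by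
  constructor
  · rintro ⟨d, hd, hl⟩
    obtain ⟨q, hq, hdq⟩ := List.mem_flatten.1 hd
    exact ⟨q, hq, hl.leftOfPath (List.mem_map_of_mem hdq) (isChain_follows_map (hB q hq))⟩
  · rintro ⟨q, hq, hf⟩
    obtain ⟨d, hd⟩ := List.exists_mem_of_ne_nil q (hB q hq).1
    exact ⟨d, List.mem_flatten_of_mem hq hd, hf _ (List.mem_map_of_mem hd)⟩

theorem exists_follows_of_boundaryNext {d d' : X.toTiledSurface.Dart}
    (hbetween : X.toTiledSurface.Between d d' 1) (hnext : X.toTiledSurface.BoundaryNext d d')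
    {f : Z.F} (hf : Z.LeftOf f (X.incl.onDart d)) :
    ∃ h, h.1 ∉ X.edges ∧
      Z.Follows (X.incl.onDart d) h ∧ Z.Follows (Z.rev h) (X.incl.onDart d') := by
  obtain ⟨h, hh⟩ := hf.exists_follows
  refine ⟨h, fun hX => ?_, hh, (X.incl.between_onDart hbetween).rev_follows hh⟩
  refine hnext.not_exists_follows hbetween ⟨(⟨h.1, hX⟩, h.2), Subtype.ext ?_, hh.2⟩
  exact (X.coe_dartTgt d).trans (hh.1.trans (X.coe_dartSrc (⟨h.1, hX⟩, h.2)).symm)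

theorem hasInnerNext_and_hasInnerPrev {S : Set Z.F} {q q' : List X.toTiledSurface.Dart}
    (hq : X.toTiledSurface.IsBlock q) (hq' : X.toTiledSurface.IsBlock q')
    (hcons : X.toTiledSurface.Consecutive q q')
    (hnext : ∀ d ∈ q.getLast?, ∀ d' ∈ q'.head?, X.toTiledSurface.BoundaryNext d d')
    (hface : ∃ f ∈ S, Z.LeftOfPath f (q.map X.incl.onDart))
    (hface' : ∃ f ∈ S, Z.LeftOfPath f (q'.map X.incl.onDart)) :
    X.HasInnerNext S (q.map X.incl.onDart) ∧ X.HasInnerPrev S (q'.map X.incl.onDart) := by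
  obtain ⟨f, hfS, hf⟩ := hface
  obtain ⟨f', hfS', hf'⟩ := hface'
  have hlast := List.getLast?_eq_some_getLast hq.1
  have hhead := List.head?_eq_some_head hq'.1
  have hf_last := hf _ (List.mem_map_of_mem (List.getLast_mem hq.1))
  have hf_head := hf' _ (List.mem_map_of_mem (List.head_mem hq'.1))
  obtain ⟨h, hh, hfollows, hrev⟩ := exists_follows_of_boundaryNext (hcons.between hq.1 hq'.1)
    (hnext _ hlast _ hhead) hf_last
  refine ⟨⟨h, hh, Or.inr ⟨f', hfS', hf_head.of_follows_left hrev⟩, ?_⟩,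
    ⟨Z.rev h, hh, Or.inr ⟨f, hfS, ?_⟩, ?_⟩⟩
  · refine List.isChain_append.2 ⟨isChain_follows_map hq, List.isChain_singleton _, ?_⟩
    simp only [List.getLast?_map, hlast, List.head?_cons, Option.map_some, Option.mem_some,
      forall_eq']
    exact hfollows
  · rw [rev_rev]
    exact hf_last.of_follows hfollows
  · refine List.isChain_cons.2 ⟨?_, isChain_follows_map hq'⟩
    simp only [List.head?_map, hhead, Option.map_some, Option.mem_some, forall_eq']
    exact hrev

theorem boundaryLength_adjoin_of_isLongBlock (hZ : Z.BoundaryReduced) (hX : X.edges.Finite)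
    {p : List X.toTiledSurface.Dart} (hb : X.toTiledSurface.IsBoundaryPath p)
    (hp : X.toTiledSurface.IsLongBlock p) :
    (X.adjoin (X.facesAlong p)).toTiledSurface.boundaryLength + 2 ≤
      X.toTiledSurface.boundaryLength := by
  obtain ⟨f, hf⟩ := X.incl.exists_leftOfPath_of_isLongBlock hZ hp
  obtain ⟨d, hd⟩ := List.exists_mem_of_ne_nil p hp.1.1
  have hfS : f ∈ X.facesAlong p := ⟨d, hd, hf _ (List.mem_map_of_mem hd)⟩
  have eq_of_mem : ∀ f' ∈ X.facesAlong p, f' = f := fun f' ⟨d, hd, hl⟩ =>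
    hl.face_unique (hf _ (List.mem_map_of_mem hd))
  set L := (p.map X.incl.onDart).take (2 * g + 1)
  have hL : L.IsChain Z.Follows := (isChain_follows_map hp.1).take _
  have hlen : L.length = 2 * g + 1 := by simpa [L] using hp.2
  have hfL : Z.LeftOfPath f L := fun d hd => hf d (List.mem_of_mem_take hd)
  have hLX : ∀ d ∈ L, d.1 ∈ X.edges := fun d hd =>
    mem_edges_of_mem_map p d (List.mem_of_mem_take hd)
  have hpos := (Z.letter (X.incl.onDart d)).genus_pos
  have hold := length_le_card_oldSides (nodup_of_isChain_follows hL (by omega)) hfL hLX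
  have hexposed := card_exposedSides_lt (S := X.facesAlong p) hL hlen hfL
    fun d hd => Or.inl (hLX d hd)
  refine boundaryLength_adjoin_add_two_le hX (X.finite_facesAlong p)
    (notMem_faces_of_mem_facesAlong hb) hfS hfS fun f' hf' => ?_
  rw [eq_of_mem f' hf', if_pos rfl]
  omega

theorem isChain_hasInnerNext_and_hasInnerPrev {S : Set Z.F} {B : List (List X.toTiledSurface.Dart)}
    (hb : X.toTiledSurface.IsBoundaryPath B.flatten) (hB : X.toTiledSurface.IsBlockChain B)
    (hface : ∀ q ∈ B, ∃ f ∈ S, Z.LeftOfPath f (q.map X.incl.onDart)) :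
    B.IsChain fun q q' =>
      X.HasInnerNext S (q.map X.incl.onDart) ∧ X.HasInnerPrev S (q'.map X.incl.onDart) := by
  have hnext := ((List.isChain_flatten fun h => (hB.1 [] h).1 rfl).1 hb.2).2
  have hboth : B.IsChain fun q q' => X.toTiledSurface.Consecutive q q' ∧
      ∀ d ∈ q.getLast?, ∀ d' ∈ q'.head?, X.toTiledSurface.BoundaryNext d d' :=
    List.isChain_iff_getElem.2 fun i hi =>
      ⟨List.isChain_iff_getElem.1 hB.2 i hi, List.isChain_iff_getElem.1 hnext i hi⟩
  exact hboth.imp_of_mem_imp fun q q' hq hq' h =>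
    hasInnerNext_and_hasInnerPrev (hB.1 q hq) (hB.1 q' hq') h.1 h.2 (hface q hq) (hface q' hq')

theorem boundaryLength_adjoin_of_isLongChain (hZ : Z.BoundaryReduced) (hX : X.edges.Finite)
    {p : List X.toTiledSurface.Dart} (hb : X.toTiledSurface.IsBoundaryPath p)
    (hp : X.toTiledSurface.IsLongChain p) :
    (X.adjoin (X.facesAlong p)).toTiledSurface.boundaryLength + 2 ≤
      X.toTiledSurface.boundaryLength := by
  obtain ⟨B, k, rfl, hB, hlen⟩ := hp
  have hleft := X.incl.exists_leftOfPath_of_isBlockChain hZ hB hlen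
  set S := X.facesAlong B.flatten
  have exists_face : ∀ q ∈ B, ∃ f ∈ S, Z.LeftOfPath f (q.map X.incl.onDart) := fun q hq =>
    (hleft q hq).imp fun f hf => ⟨(mem_facesAlong_flatten hB.1).2 ⟨q, hq, hf⟩, hf⟩
  have hinner := isChain_hasInnerNext_and_hasInnerPrev hb hB exists_face
  obtain ⟨q₀, R, rfl, hlen₀, hR⟩ := List.map_eq_cons_iff.1 hlen
  obtain ⟨M, T, rfl, hM, hT⟩ := List.map_eq_append_iff.1 hR
  obtain ⟨q₁, rfl, hlen₁⟩ := List.map_eq_singleton_iff.1 hT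
  obtain ⟨hnext₀, hprev₁, hmiddle⟩ := forall_and_of_isChain_cons_concat hinner
  obtain ⟨f₀, hf₀S, hf₀⟩ := exists_face q₀ (by simp)
  obtain ⟨f₁, hf₁S, hf₁⟩ := exists_face q₁ (by simp)
  rw [← List.length_map X.incl.onDart] at hlen₀ hlen₁
  have hlt₀ := hnext₀.card_exposedSides_lt (mem_edges_of_mem_map q₀) hlen₀ hf₀
  have hlt₁ := hprev₁.card_exposedSides_lt (mem_edges_of_mem_map q₁) hlen₁ hf₁
  refine boundaryLength_adjoin_add_two_le hX (X.finite_facesAlong _)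
    (notMem_faces_of_mem_facesAlong hb) hf₀S hf₁S fun f hf => ?_
  split_ifs with h₀ h₁ h₁
  · subst h₀ h₁
    exact card_exposedSides_add_two_le (mem_edges_of_mem_map q₀) (mem_edges_of_mem_map q₁)
      hlen₀ hlen₁ hf₀ hf₁ hnext₀ hprev₁
  · exact h₀ ▸ hlt₀
  · exact h₁ ▸ hlt₁
  · obtain ⟨q, hq, hfq⟩ := (mem_facesAlong_flatten hB.1).1 hf
    have hne : q.map X.incl.onDart ≠ [] := mt List.map_eq_nil_iff.1 (hB.1 q hq).1
    simp only [List.mem_cons, List.mem_append, List.not_mem_nil, or_false] at hq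
    obtain rfl | hqM | rfl := hq
    · exact absurd (hfq.face_unique hf₀ hne) h₀
    · exact card_exposedSides_le (mem_edges_of_mem_map q)
        ((List.length_map _).trans (List.eq_of_mem_replicate (hM ▸ List.mem_map_of_mem hqM)))
        hfq (hmiddle q hqM).1 (hmiddle q hqM).2
    · exact absurd (hfq.face_unique hf₁ hne) h₁

theorem Step.boundaryLength_add_two_le (hZ : Z.BoundaryReduced) {X' : Subcomplex Z}
    (h : X.Step X') (hX : X.edges.Finite) :
    X'.toTiledSurface.boundaryLength + 2 ≤ X.toTiledSurface.boundaryLength := by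
  obtain ⟨p, hb, hp | hp, rfl⟩ := h
  · exact boundaryLength_adjoin_of_isLongBlock hZ hX hb hp
  · exact boundaryLength_adjoin_of_isLongChain hZ hX hb hp

theorem exists_step (h : ¬ X.toTiledSurface.BoundaryReduced) : ∃ X', X.Step X' := by
  simp only [BoundaryReduced, not_forall, not_and_or, not_not] at h
  obtain ⟨p, hb, hp⟩ := h
  exact ⟨_, p, hb, hp, rfl⟩

end Step

theorem exists_step_sequence (hZ : Z.BoundaryReduced) (X₀ : Subcomplex Z)
    (hX₀ : X₀.toTiledSurface.IsCompact) :
    ∃ (n : ℕ) (X : ℕ → Subcomplex Z), X 0 = X₀ ∧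
      IsLeast {W | X₀ ≤ W ∧ W.toTiledSurface.BoundaryReduced} (X n) ∧
      (X n).toTiledSurface.IsCompact ∧
      ∀ i < n, (X i).Step (X (i + 1)) ∧
        (X (i + 1)).toTiledSurface.boundaryLength + 2 ≤ (X i).toTiledSurface.boundaryLength := by
  induction hN : X₀.toTiledSurface.boundaryLength using Nat.strong_induction_on
    generalizing X₀ with
  | _ N ih =>
    by_cases hbr : X₀.toTiledSurface.BoundaryReduced
    · exact ⟨0, fun _ => X₀, rfl, ⟨⟨le_rfl, hbr⟩, fun W hW => hW.1⟩, hX₀, nofun⟩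
    · obtain ⟨X₁, hstep⟩ := exists_step hbr
      have hlength := hstep.boundaryLength_add_two_le hZ hX₀.2.1
      obtain ⟨n, X, rfl, hleast, hcompact, hsteps⟩ :=
        ih _ (by omega) X₁ (hstep.isCompact hX₀) rfl
      have upper_eq : {W | X 0 ≤ W ∧ W.toTiledSurface.BoundaryReduced} =
          {W | X₀ ≤ W ∧ W.toTiledSurface.BoundaryReduced} :=
        Set.ext fun W => and_congr_left fun hW => hstep.le_iff hW
      refine ⟨n + 1, fun i => Nat.casesOn i X₀ X, rfl, upper_eq ▸ hleast, hcompact, ?_⟩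
      rintro (_ | i) hi
      · exact ⟨hstep, hlength⟩
      · exact hsteps i (by omega)

end Subcomplex

/-! ### The strongly boundary reduced closure need not be compact -/

namespace IntegerCover

/-- The images of the generators of the surface group of genus two under the homomorphism to the
integers that defines the covering. With this choice, successive octagons of the covering share
the half-block that reads `a₀⁻¹ b₀⁻¹ a₁ b₁`. -/
def shift : SurfaceGen 2 → ℤ
  | .a 0 => 1
  | .b 0 => -1
  | .a 1 => -1
  | .b 1 => 1

/-- The extension of `shift` to letters. -/
def letterShift (x : Letter 2) : ℤ := if x.2 then shift x.1 else -shift x.1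

/-- The homomorphism from the surface group to the integers given by `shift`. -/
def shiftHom : SurfaceGroup 2 →* Multiplicative ℤ :=
  PresentedGroup.toGroup (f := fun x => Multiplicative.ofAdd (shift x)) (by
    rintro r rfl
    rfl)

theorem toAdd_shiftHom_wordValue (w : List (Letter 2)) :
    (shiftHom (wordValue w)).toAdd = (w.map letterShift).sum := by
  change (FreeGroup.lift (fun x => Multiplicative.ofAdd (shift x)) (FreeGroup.mk w)).toAdd = _
  rw [FreeGroup.lift_mk, toAdd_list_sum, List.map_map]
  refine congrArg List.sum (List.map_congr_left ?_)
  rintro ⟨i, _ | _⟩ _ <;> rfl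

/-- The terminal vertex of the edge of the covering that starts at `e.1` and lies over `e.2`. -/
def target (e : ℤ × SurfaceGen 2) : ℤ := e.1 + shift e.2

theorem dartTgt_eq_dartSrc_add (d : (ℤ × SurfaceGen 2) × Bool) :
    LabeledGraph.dartTgt Prod.fst target d =
      LabeledGraph.dartSrc Prod.fst target d +
        letterShift (LabeledGraph.dartLetter Prod.snd d) := by
  rcases d with ⟨e, _ | _⟩ <;>
    simp [LabeledGraph.dartTgt, LabeledGraph.dartSrc, LabeledGraph.dartLetter, letterShift, target]

theorem isClosed_of_wordValue_eq_one {p : List ((ℤ × SurfaceGen 2) × Bool)}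
    (hp : LabeledGraph.IsPath Prod.fst target p)
    (hw : wordValue (p.map (LabeledGraph.dartLetter Prod.snd)) = 1) :
    LabeledGraph.IsClosed Prod.fst target p := by
  rcases eq_or_ne p [] with rfl | hne
  · rfl
  have htarget := target_getLast_eq_source_head_add_sum dartTgt_eq_dartSrc_add hp hne
  have hsum := toAdd_shiftHom_wordValue (p.map (LabeledGraph.dartLetter Prod.snd))
  rw [hw, map_one, toAdd_one, List.map_map] at hsum
  rw [LabeledGraph.IsClosed, List.head?_eq_some_head hne, List.getLast?_eq_some_getLast hne,
    Option.map_some, Option.map_some, htarget]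
  exact congrArg some (left_eq_add.2 hsum.symm)

/-- The attaching path of the octagon of the covering that starts at the vertex `n`. -/
def octagon (n : ℤ) : List ((ℤ × SurfaceGen 2) × Bool) :=
  [((n, .a 0), true), ((n + 1, .b 0), true), ((n - 1, .a 0), false), ((n, .b 0), false),
    ((n, .a 1), true), ((n - 1, .b 1), true), ((n + 1, .a 1), false), ((n, .b 1), false)]

/-- The infinite cyclic covering of the closed surface of genus two given by `shiftHom`. -/
def surface : TiledSurface.{0} 2 where
  V := ℤ
  E := ℤ × SurfaceGen 2
  F := ℤ
  src := Prod.fst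
  tgt := target
  label := Prod.snd
  bdry := octagon
  out_unique _ _ hsrc hlabel := Prod.ext hsrc hlabel
  in_unique e e' htgt hlabel := by
    rw [target, target, hlabel] at htgt
    exact Prod.ext (add_right_cancel htgt) hlabel
  closed_of_trivial _ := isClosed_of_wordValue_eq_one
  bdry_isPath n := by
    simp [LabeledGraph.IsPath, octagon, LabeledGraph.dartTgt, LabeledGraph.dartSrc, target, shift,
      sub_eq_add_neg]
  bdry_isClosed n := by
    simp [LabeledGraph.IsClosed, octagon, LabeledGraph.dartTgt, LabeledGraph.dartSrc]
  bdry_word _ := rfl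
  bdry_injective n n' h := congrArg (fun d => d.1.1) (List.cons.inj h).1

theorem exists_mem_octagon (d : (ℤ × SurfaceGen 2) × Bool) : ∃ n, d ∈ octagon n := by
  obtain ⟨⟨n, i⟩, s⟩ := d
  rcases i with i | i <;> fin_cases i <;> cases s
  · exact ⟨n + 1, by simp [octagon]⟩
  · exact ⟨n, by simp [octagon]⟩
  · exact ⟨n - 1, by simp [octagon]⟩
  · exact ⟨n, by simp [octagon]⟩
  · exact ⟨n, by simp [octagon]⟩
  · exact ⟨n - 1, by simp [octagon]⟩
  · exact ⟨n, by simp [octagon]⟩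
  · exact ⟨n + 1, by simp [octagon]⟩

theorem not_isBoundaryDart (d : surface.Dart) : ¬ surface.IsBoundaryDart d := fun h =>
  (exists_mem_octagon d).elim h

theorem stronglyBoundaryReduced_surface : surface.StronglyBoundaryReduced := by
  have eq_nil : ∀ p, surface.IsBoundaryPath p → p = [] := fun p hp =>
    List.eq_nil_iff_forall_not_mem.2 fun d hd => not_isBoundaryDart d (hp.1 d hd)
  exact ⟨fun p hp hblock => hblock.1.1 (eq_nil p hp), fun p hp _ => hp.1 (eq_nil p hp.2.1)⟩

/-- The sub-complex that consists of the closed octagon starting at the vertex `0`. -/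
def closedOctagon : Subcomplex surface :=
  Subcomplex.adjoin ⟨∅, ∅, ∅, nofun, nofun, nofun⟩ {(0 : ℤ)}

theorem isCompact_closedOctagon : closedOctagon.toTiledSurface.IsCompact :=
  Subcomplex.isCompact_adjoin
    ((Subcomplex.isCompact_iff _).2 ⟨Set.finite_empty, Set.finite_empty, Set.finite_empty⟩)
    (Set.finite_singleton _)

/-- The half-block that the octagon `n + 1` shares with the octagon `n`. -/
def sharedHalfBlock (n : ℤ) : List ((ℤ × SurfaceGen 2) × Bool) :=
  [((n, .a 0), false), ((n + 1, .b 0), false), ((n + 1, .a 1), true), ((n, .b 1), true)]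

theorem leftOfPath_sharedHalfBlock (n : ℤ) :
    surface.LeftOfPath (n + 1 : ℤ) (sharedHalfBlock n) := by
  have hsubset : sharedHalfBlock n ⊆ octagon (n + 1) := by
    simp [sharedHalfBlock, octagon]
  exact fun d hd => hsubset hd

theorem succ_mem_faces {X : Subcomplex surface} (hX : X.toTiledSurface.StronglyBoundaryReduced)
    {n : ℤ} (hn : n ∈ X.faces) : (n + 1 : ℤ) ∈ X.faces := by
  by_contra hsucc
  have edge_mem : ∀ d ∈ octagon n, d.1 ∈ X.edges := X.bdry_mem n hn
  let p : List X.toTiledSurface.Dart :=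
    [(⟨(n, .a 0), edge_mem ((n, .a 0), true) (by simp [octagon])⟩, false),
      (⟨(n + 1, .b 0), edge_mem ((n + 1, .b 0), true) (by simp [octagon])⟩, false),
      (⟨(n + 1, .a 1), edge_mem ((n + 1, .a 1), false) (by simp [octagon])⟩, true),
      (⟨(n, .b 1), edge_mem ((n, .b 1), false) (by simp [octagon])⟩, true)]
  have hblock : X.toTiledSurface.IsBlock p := by
    refine isBlock_iff.2 ⟨List.cons_ne_nil _ _, ?_⟩
    simp only [p, List.isChain_cons_cons, List.isChain_singleton, and_true]
    exact ⟨⟨Subtype.ext (add_neg_cancel_right n 1).symm, rfl⟩, ⟨Subtype.ext rfl, rfl⟩,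
      Subtype.ext (add_neg_cancel_right n 1), rfl⟩
  have hboundary : X.toTiledSurface.IsBoundaryPath p :=
    hblock.isBoundaryPath fun d hd f hf => by
      have hleft : surface.LeftOf (n + 1 : ℤ) (X.incl.onDart d) :=
        leftOfPath_sharedHalfBlock n _ (List.mem_map_of_mem hd)
      exact hsucc (hleft.face_unique (X.leftOf_iff.1 hf) ▸ f.2)
  exact hX.1 p hboundary ⟨hblock, rfl⟩

theorem not_isCompact_sbrClosure : ¬ closedOctagon.incl.sbrClosure.toTiledSurface.IsCompact := by
  intro hcompact
  have mem_faces (n : ℕ) : ((n : ℤ) : surface.F) ∈ closedOctagon.incl.sbrClosure.faces := by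
    intro X hX
    induction n with
    | zero => exact hX.1.2.2 ⟨⟨(0 : ℤ), Or.inr rfl⟩, rfl⟩
    | succ n ih => exact Nat.cast_succ (R := ℤ) n ▸ succ_mem_faces hX.2 ih
  have infinite_range : (Set.range fun n : ℕ => (n : ℤ)).Infinite :=
    Set.infinite_range_of_injective Nat.cast_injective
  exact infinite_range (((Subcomplex.isCompact_iff _).1 hcompact).2.2.subset
    (Set.range_subset_iff.2 mem_faces))

end IntegerCover

end TiledSurface

theorem proposition4p4_general :
    (∀ (g : ℕ) (Y : TiledSurface.{u} g) (Z : TiledSurface.{v} g)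
      (φ : TiledSurface.Hom Y Z), Y.IsCompact → Z.BoundaryReduced →
      φ.brClosure.toTiledSurface.IsCompact ∧
      ∃ (n : ℕ) (X : ℕ → TiledSurface.Subcomplex Z),
        X 0 = φ.range ∧ X n = φ.brClosure ∧
        ∀ i < n, (X i).Step (X (i + 1)) ∧
          (X (i + 1)).toTiledSurface.boundaryLength + 2 ≤
            (X i).toTiledSurface.boundaryLength) ∧
    (∃ (Y Z : TiledSurface.{0} 2) (φ : TiledSurface.Hom Y Z), φ.IsEmbedding ∧ Y.IsCompact ∧
      Z.StronglyBoundaryReduced ∧ ¬ φ.sbrClosure.toTiledSurface.IsCompact) := by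
  refine ⟨fun g Y Z φ hY hZ => ?_, ?_⟩
  · obtain ⟨n, X, hzero, hleast, hcompact, hsteps⟩ :=
      TiledSurface.Subcomplex.exists_step_sequence hZ φ.range (φ.isCompact_range hY)
    have hclosure : φ.brClosure = X n := TiledSurface.Subcomplex.inter_eq_of_isLeast hleast
    exact ⟨hclosure ▸ hcompact, n, X, hzero, hclosure.symm, hsteps⟩
  · exact ⟨_, _, TiledSurface.IntegerCover.closedOctagon.incl,
      ⟨Subtype.val_injective, Subtype.val_injective, Subtype.val_injective⟩,
      TiledSurface.IntegerCover.isCompact_closedOctagon,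
      TiledSurface.IntegerCover.stronglyBoundaryReduced_surface,
      TiledSurface.IntegerCover.not_isCompact_sbrClosure⟩

theorem proposition4p4 :
    (∀ (g : ℕ), 2 ≤ g → ∀ (Y : TiledSurface.{u} g) (Z : TiledSurface.{v} g)
      (φ : TiledSurface.Hom Y Z), φ.IsEmbedding → Y.IsCompact → Z.BoundaryReduced →
      φ.brClosure.toTiledSurface.IsCompact ∧
      ∃ (n : ℕ) (X : ℕ → TiledSurface.Subcomplex Z),
        X 0 = φ.range ∧ X n = φ.brClosure ∧
        ∀ i < n, (X i).Step (X (i + 1)) ∧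
          (X (i + 1)).toTiledSurface.boundaryLength + 2 ≤
            (X i).toTiledSurface.boundaryLength) ∧
    (∃ (Y Z : TiledSurface.{0} 2) (φ : TiledSurface.Hom Y Z), φ.IsEmbedding ∧ Y.IsCompact ∧
      Z.StronglyBoundaryReduced ∧ ¬ φ.sbrClosure.toTiledSurface.IsCompact) := by
  exact proposition4p4_general.imp_left fun h g _ Y Z φ _ => h g Y Z φ
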